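/- **Setting.** Let $Q\in\mathbb R^{n\times n}$ be symmetric positive semidefinite, $q\in\mathbb R^n$, $G\in\mathbb R^{p\times n}$, $g\in\mathbb R^p$, let $U\subseteq\mathbb R^n$ be compact and convex (e.g. a box), let $\mathcal K$ be either $\mathbb R^p_-$ or $\{0\}$, and consider $$F^*=\min\{F(u)=\tfrac12u^TQu+q^Tu:\ u\in U,\ Gu+g\in\mathcal K\},$$ assumed feasible and admitting an optimal Lagrange multiplier. Either $Q\succ0$ and $\rho=0$, or $Q$ is positive semidefinite but not positive definite and $\rho>0$. Write $[x]_X$ for the Euclidean projection onto $X$. Put $s(u,\lambda)=0$ if $\rho=0$ and $s(u,\lambda)=[Gu+g+\lambda/\rho]_{\mathcal K}$ if $\rho>0$, let $r(u,\lambda)=Gu+g-s(u,\lambda)$, and let $$\mathcal L_\rho(u,\lambda)=F(u)+\langle\lambda,r(u,\lambda)\rangle+\tfrac\rho2\|r(u,\lambda)\|^2,\qquad d_\rho(\lambda)=\min_{u\in U}\mathcal L_\rho(u,\lambda).$$ Let $\mathcal K_d=\mathbb R^p_+$ if $Q\succ0$ and $\mathcal K=\mathbb R^p_-$, and $\mathcal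 K_d=\mathbb R^p$ otherwise. Let $\Lambda^*$ be the set of maximizers of $d_\rho$ over $\mathcal K_d$, and put $L_d=\|G\|^2/(\lambda_{\min}(Q)+\rho\|G\|^2)$ and, for the starting point $\lambda^0=0$, $R_d=\min_{\lambda^*\in\Lambda^*}\|\lambda^*-\lambda^0\|$. For $\mu\in\mathbb R^p$ let $\bar u(\mu)$ denote any point of $U$ with $0\le\mathcal L_\rho(\bar u(\mu),\mu)-d_\rho(\mu)\le\epsilon_{\rm in}$, and let $T(\mu)=\big[\mu+\tfrac1{2L_d}r(\bar u(\mu),\mu)\big]_{\mathcal K_d}$ be an inexact dual gradient step. **Algorithm DFOM.** Start with $\mu^1=\lambda^0=0$; for $k\ge1$ put $\lambda^k=T(\mu^k)$ and $\mu^{k+1}=\lambda^k+\frac{\theta_k-1}{\theta_{k+1}}(\lambda^k-\lambda^{k-1})$, where $\theta_k\equiv1$ (DGM), or $\theta_1=1$, $\theta_{k+1}=\frac{1+\sqrt{1+4\theta_k^2}}2$ (DFGM). When the method is stopped after $k$ outer iterations, its dual last iterate $\lambda^k_\epsilon$ is $\lambda^k$ for DFGM, and $T(\hat\lambda^k)$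 with $\hat\lambda^k=\frac1{k+1}\sum_{j=0}^k\lambda^j$ for DGM. The primal last iterate is $\bar u^k_\epsilon=\bar u(\lambda^k_\epsilon)$, again computed with inner accuracy $\epsilon_{\rm in}$. **Theorem.** Let $\epsilon>0$ and let $$\epsilon_{\rm in}=\frac\epsilon4,\quad \kappa=\frac{8L_dR_d^2}{\epsilon}\quad\text{(DGM)},\qquad \epsilon_{\rm in}=\frac{\epsilon\sqrt\epsilon}{8R_d\sqrt{2L_d}},\quad \kappa=\sqrt{\frac{8L_dR_d^2}{\epsilon}}\quad\text{(DFGM)}.$$ Assume $\kappa\ge1$ and let $k_{\rm out}=\lceil\kappa\rceil$. Then, for either scheme, the primal last iterate $\bar u=\bar u_\epsilon^{k_{\rm out}}$ satisfies, with $$B=\max\Big\{\frac{(L_d\epsilon)^{1/2}}{\sqrt2},\ \frac{L_d^{1/4}}{(3R_d)^{1/2}}\,\epsilon^{3/4}\Big\}+(2L_d\epsilon)^{1/2},$$ the bounds $$\operatorname{dist}_{\mathcal K}(G\bar u+g)\le B,\qquad |F(\bar u)-F^*|\le4R_dB+\epsilon_{\rm in},$$ and in particular it is a $\sqrt\epsilon$-primal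 solution: $$\operatorname{dist}_{\mathcal K}(G\bar u+g)\le3\sqrt{L_d}\,\sqrt\epsilon,\qquad |F(\bar u)-F^*|\le11\,R_d\sqrt{L_d}\,\sqrt\epsilon .$$ -/

import Mathlib

open scoped RealInnerProductSpace

noncomputable section

namespace DuQuad

/-- A nearest point of `S` to `x`, for the Euclidean norm (the metric projection `[x]_S`).
For nonempty closed convex `S` it exists and is unique, see `proj_spec` and `proj_unique`. -/
def proj {m : ℕ} (S : Set (EuclideanSpace ℝ (Fin m))) (x : EuclideanSpace ℝ (Fin m)) :
    EuclideanSpace ℝ (Fin m) :=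
  Classical.epsilon fun y => y ∈ S ∧ ∀ z ∈ S, ‖x - y‖ ≤ ‖x - z‖

theorem proj_spec {m : ℕ} {S : Set (EuclideanSpace ℝ (Fin m))} (hne : S.Nonempty)
    (hcl : IsClosed S) (x : EuclideanSpace ℝ (Fin m)) :
    proj S x ∈ S ∧ ∀ z ∈ S, ‖x - proj S x‖ ≤ ‖x - z‖ := by
  have h : ∃ y, y ∈ S ∧ ∀ z ∈ S, ‖x - y‖ ≤ ‖x - z‖ := by
    obtain ⟨y, hy, hxy⟩ := hcl.exists_infDist_eq_dist hne x
    refine ⟨y, hy, fun z hz => ?_⟩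
    rw [← dist_eq_norm, ← dist_eq_norm, ← hxy]
    exact Metric.infDist_le_dist_of_mem hz
  exact Classical.epsilon_spec h

theorem proj_unique {m : ℕ} {S : Set (EuclideanSpace ℝ (Fin m))} (hcl : IsClosed S)
    (hconv : Convex ℝ S) {x y : EuclideanSpace ℝ (Fin m)} (hy : y ∈ S)
    (hmin : ∀ z ∈ S, ‖x - y‖ ≤ ‖x - z‖) : proj S x = y := by
  have hp := proj_spec ⟨y, hy⟩ hcl x
  have heq : ‖x - proj S x‖ = ‖x - y‖ := le_antisymm (hp.2 y hy) (hmin _ hp.1)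
  have hmid : (1 / 2 : ℝ) • proj S x + (1 / 2 : ℝ) • y ∈ S :=
    hconv hp.1 hy (by norm_num) (by norm_num) (by norm_num)
  have h1 := hmin _ hmid
  have h2 : x - ((1 / 2 : ℝ) • proj S x + (1 / 2 : ℝ) • y)
      = (1 / 2 : ℝ) • ((x - proj S x) + (x - y)) := by
    module
  rw [h2, norm_smul, Real.norm_of_nonneg (by norm_num)] at h1
  have h3 := parallelogram_law_with_norm ℝ (x - proj S x) (x - y)
  have h4 : (x - proj S x) - (x - y) = y - proj S x := by abel
  rw [h4, heq] at h3
  have h5 : ‖y - proj S x‖ = 0 := by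
    nlinarith [norm_nonneg (y - proj S x), norm_nonneg (x - y),
      norm_nonneg ((x - proj S x) + (x - y))]
  exact (sub_eq_zero.mp (norm_eq_zero.mp h5)).symm

/-- The two constraint cones: `nonpos` for `ℝ^p_-` (inequalities), `zero` for `{0}` (equalities). -/
inductive ConeType
  | nonpos
  | zero

/-- The cone `𝒦 ⊆ ℝ^p`. -/
def ConeType.toSet (p : ℕ) : ConeType → Set (EuclideanSpace ℝ (Fin p))
  | .nonpos => {s | ∀ i, s i ≤ 0}
  | .zero => {0}

/-- The data of the convex quadratic program
`F^* = min {½ uᵀQu + qᵀu : u ∈ U, G u + g ∈ 𝒦}`, with `Q ⪰ 0` and `U` compact and convex. -/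
structure QP (n p : ℕ) where
  Q : Matrix (Fin n) (Fin n) ℝ
  q : EuclideanSpace ℝ (Fin n)
  G : Matrix (Fin p) (Fin n) ℝ
  g : EuclideanSpace ℝ (Fin p)
  U : Set (EuclideanSpace ℝ (Fin n))
  cone : ConeType
  Q_posSemidef : Q.PosSemidef
  U_compact : IsCompact U
  U_convex : Convex ℝ U

/-- The two schemes: dual gradient method and dual fast gradient method. -/
inductive Scheme
  | DGM
  | DFGM

namespace QP

variable {n p : ℕ} (P : QP n p)

/-- The cone `𝒦`. -/
def K : Set (EuclideanSpace ℝ (Fin p)) := P.cone.toSet p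

/-- The objective `F(u) = ½ uᵀQu + qᵀu`. -/
def F (u : EuclideanSpace ℝ (Fin n)) : ℝ :=
  1 / 2 * ⟪u, Matrix.toEuclideanLin P.Q u⟫ + ⟪P.q, u⟫

/-- The constraint map `u ↦ G u + g`. -/
def con (u : EuclideanSpace ℝ (Fin n)) : EuclideanSpace ℝ (Fin p) :=
  Matrix.toEuclideanLin P.G u + P.g

/-- The feasible set of the QP. -/
def feasible : Set (EuclideanSpace ℝ (Fin n)) := {u | u ∈ P.U ∧ P.con u ∈ P.K}

/-- The optimal value `F^*` (a minimum as soon as the QP is feasible, by compactness of `U`). -/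
def Fstar : ℝ := sInf (P.F '' P.feasible)

/-- The spectral norm `‖G‖`, i.e. the operator norm for the Euclidean norms. -/
def normG : ℝ := ‖(Matrix.toEuclideanLin P.G).toContinuousLinearMap‖

/-- The smallest eigenvalue of `Q`. -/
def lamMin : ℝ := sInf (spectrum ℝ P.Q)

/-- The two admissible situations: `Q ≻ 0` with `ρ = 0` (ordinary Lagrangian), or `Q ⪰ 0` singular
with `ρ > 0` (augmented Lagrangian). -/
def Admissible (ρ : ℝ) : Prop :=
  (P.Q.PosDef ∧ ρ = 0) ∨ (¬ P.Q.PosDef ∧ 0 < ρ)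

/-- The slack `s(u,λ)`: `[G u + g + λ/ρ]_𝒦` if `ρ > 0`, and `0` if `ρ = 0`. -/
def slack (ρ : ℝ) (u : EuclideanSpace ℝ (Fin n)) (l : EuclideanSpace ℝ (Fin p)) :
    EuclideanSpace ℝ (Fin p) :=
  if ρ = 0 then 0 else proj P.K (P.con u + (1 / ρ) • l)

/-- The residual `G u + g - s(u,λ)`. At an approximate inner solution `u` for the multiplier `λ`
this is the inexact gradient of the (augmented) dual function. -/
def resid (ρ : ℝ) (u : EuclideanSpace ℝ (Fin n)) (l : EuclideanSpace ℝ (Fin p)) :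
    EuclideanSpace ℝ (Fin p) :=
  P.con u - P.slack ρ u l

/-- The (augmented) Lagrangian
`ℒ_ρ(u,λ) = F(u) + ⟨λ, G u + g - s(u,λ)⟩ + ρ/2 ‖G u + g - s(u,λ)‖²`;
for `ρ = 0` it is `F(u) + ⟨λ, G u + g⟩`, and for `ρ > 0` it is the minimum over `s ∈ 𝒦`,
see `lagr_zero` and `lagr_le`. -/
def lagr (ρ : ℝ) (u : EuclideanSpace ℝ (Fin n)) (l : EuclideanSpace ℝ (Fin p)) : ℝ :=
  P.F u + ⟪l, P.resid ρ u l⟫ + ρ / 2 * ‖P.resid ρ u l‖ ^ 2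

/-- The (augmented) dual function `d_ρ(λ) = min_{u ∈ U} ℒ_ρ(u,λ)`. -/
def dual (ρ : ℝ) (l : EuclideanSpace ℝ (Fin p)) : ℝ :=
  sInf ((fun u => P.lagr ρ u l) '' P.U)

open Classical in
/-- The dual domain `𝒦_d`: `ℝ^p_+` if `Q ≻ 0` and `𝒦 = ℝ^p_-`, and `ℝ^p` otherwise. -/
def Kd : Set (EuclideanSpace ℝ (Fin p)) :=
  if P.Q.PosDef ∧ P.cone = ConeType.nonpos then {l | ∀ i, 0 ≤ l i} else Set.univ

/-- An optimal Lagrange multiplier of the QP: a multiplier in the polar cone of `𝒦` for which the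
ordinary Lagrangian has minimum `F^*` over `U`. -/
def IsLagrangeMultiplier (l : EuclideanSpace ℝ (Fin p)) : Prop :=
  (∀ s ∈ P.K, ⟪l, s⟫ ≤ 0) ∧ sInf ((fun u => P.F u + ⟪l, P.con u⟫) '' P.U) = P.Fstar

/-- The set `Λ^*` of maximizers of `d_ρ` over `𝒦_d`. -/
def dualOpt (ρ : ℝ) : Set (EuclideanSpace ℝ (Fin p)) :=
  {l | l ∈ P.Kd ∧ ∀ l' ∈ P.Kd, P.dual ρ l' ≤ P.dual ρ l}

/-- `L_d = ‖G‖² / (λ_min(Q) + ρ ‖G‖²)`. -/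
def Ld (ρ : ℝ) : ℝ := P.normG ^ 2 / (P.lamMin + ρ * P.normG ^ 2)

/-- `R_d = min_{λ^* ∈ Λ^*} ‖λ^* - λ^0‖`. -/
def Rd (ρ : ℝ) (l0 : EuclideanSpace ℝ (Fin p)) : ℝ := Metric.infDist l0 (P.dualOpt ρ)

/-- `u` solves the inner problem for the multiplier `μ` with accuracy `εin`:
`u ∈ U` and `0 ≤ ℒ_ρ(u,μ) - d_ρ(μ) ≤ εin`. -/
def InnerSol (ρ εin : ℝ) (μ : EuclideanSpace ℝ (Fin p)) (u : EuclideanSpace ℝ (Fin n)) : Prop :=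
  u ∈ P.U ∧ 0 ≤ P.lagr ρ u μ - P.dual ρ μ ∧ P.lagr ρ u μ - P.dual ρ μ ≤ εin

/-- One inexact dual gradient step `[μ + (1 / (2 L_d)) (G u + g - s(u,μ))]_{𝒦_d}`. -/
def dualStep (ρ : ℝ) (u : EuclideanSpace ℝ (Fin n)) (μ : EuclideanSpace ℝ (Fin p)) :
    EuclideanSpace ℝ (Fin p) :=
  proj P.Kd (μ + (1 / (2 * P.Ld ρ)) • P.resid ρ u μ)

end QP

/-- `θ_1 = 1`, `θ_{k+1} = (1 + √(1 + 4 θ_k²)) / 2`; the (unused) value `θ_0 = 0` makes the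
recursion produce `θ_1 = 1`. -/
def fastTheta : ℕ → ℝ
  | 0 => 0
  | k + 1 => (1 + √(1 + 4 * fastTheta k ^ 2)) / 2

/-- `θ_k ≡ 1` for DGM, Nesterov's sequence for DFGM. -/
def theta : Scheme → ℕ → ℝ
  | .DGM, _ => 1
  | .DFGM, k => fastTheta k

/-- `β_k = (θ_k - 1) / θ_{k+1}`. -/
def beta (m : Scheme) (k : ℕ) : ℝ := (theta m k - 1) / theta m (k + 1)

/-- The choice of the inner accuracy, as a function of `ε`, `L_d`, `R_d`. -/
def epsIn (m : Scheme) (ε L R : ℝ) : ℝ :=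
  match m with
  | .DGM => ε / 4
  | .DFGM => ε * √ε / (8 * R * √(2 * L))

/-- The prescribed number of outer iterations, as a real number. -/
def kOutReal (m : Scheme) (ε L R : ℝ) : ℝ :=
  match m with
  | .DGM => 8 * L * R ^ 2 / ε
  | .DFGM => √(8 * L * R ^ 2 / ε)

/-- The prescribed number of outer iterations, rounded up to an integer. -/
def kOut (m : Scheme) (ε L R : ℝ) : ℕ := ⌈kOutReal m ε L R⌉₊

/-- `(λ^k)_{k ≥ 0}`, `(μ^k)_{k ≥ 1}`, `(ū^k)_{k ≥ 1}` are generated by the inexact dual first order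
method started at `λ^0 = l0`, with inner accuracy `εin` (the values `mu 0`, `u 0` are unused). -/
structure IsDFOM {n p : ℕ} (P : QP n p) (ρ : ℝ) (m : Scheme) (εin : ℝ)
    (l0 : EuclideanSpace ℝ (Fin p)) (lam mu : ℕ → EuclideanSpace ℝ (Fin p))
    (u : ℕ → EuclideanSpace ℝ (Fin n)) : Prop where
  start_mem : l0 ∈ P.Kd
  lam_zero : lam 0 = l0
  mu_one : mu 1 = l0
  inner : ∀ k, 1 ≤ k → P.InnerSol ρ εin (mu k) (u k)
  step : ∀ k, 1 ≤ k → lam k = P.dualStep ρ (u k) (mu k)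
  extrapolate : ∀ k, 1 ≤ k → mu (k + 1) = lam k + beta m k • (lam k - lam (k - 1))

/-- The average `(λ^0 + ⋯ + λ^k) / (k + 1)`. -/
def avg {p : ℕ} (lam : ℕ → EuclideanSpace ℝ (Fin p)) (k : ℕ) : EuclideanSpace ℝ (Fin p) :=
  (1 / ((k : ℝ) + 1)) • ∑ j ∈ Finset.range (k + 1), lam j

/-- `l` is the dual last iterate delivered when the method stops after `k` outer iterations:
for DFGM it is `λ^k`; for DGM it is the point obtained by one inexact dual gradient step from the
average of `λ^0, …, λ^k`. -/
def IsDualLast {n p : ℕ} (P : QP n p) (ρ : ℝ) (m : Scheme) (εin : ℝ)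
    (lam : ℕ → EuclideanSpace ℝ (Fin p)) (k : ℕ) (l : EuclideanSpace ℝ (Fin p)) : Prop :=
  match m with
  | .DGM => ∃ w, P.InnerSol ρ εin (avg lam k) w ∧ l = P.dualStep ρ w (avg lam k)
  | .DFGM => l = lam k

/-- The bound on the infeasibility of the last primal iterate. -/
def feasBound (ε L R : ℝ) : ℝ :=
  max (√(L * ε) / √2) (L ^ (1 / 4 : ℝ) / √(3 * R) * ε ^ (3 / 4 : ℝ)) + √(2 * L * ε)

namespace QP

variable {n p : ℕ} (P : QP n p)

theorem K_nonempty : P.K.Nonempty := by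
  refine ⟨0, ?_⟩
  unfold K
  cases P.cone <;> simp [ConeType.toSet]

theorem K_closed : IsClosed P.K := by
  unfold K
  cases P.cone
  · simp only [ConeType.toSet, Set.ofPred_forall]
    exact isClosed_iInter fun i => isClosed_le (by fun_prop) continuous_const
  · exact isClosed_singleton

theorem lagr_zero (u : EuclideanSpace ℝ (Fin n)) (l : EuclideanSpace ℝ (Fin p)) :
    P.lagr 0 u l = P.F u + ⟪l, P.con u⟫ := by
  simp [lagr, resid, slack]

theorem slack_mem {ρ : ℝ} (hρ : 0 < ρ) (u : EuclideanSpace ℝ (Fin n))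
    (l : EuclideanSpace ℝ (Fin p)) : P.slack ρ u l ∈ P.K := by
  rw [slack, if_neg hρ.ne']
  exact (proj_spec P.K_nonempty P.K_closed _).1

theorem lagr_le {ρ : ℝ} (hρ : 0 < ρ) (u : EuclideanSpace ℝ (Fin n))
    (l s : EuclideanSpace ℝ (Fin p)) (hs : s ∈ P.K) :
    P.lagr ρ u l ≤ P.F u + ⟪l, P.con u - s⟫ + ρ / 2 * ‖P.con u - s‖ ^ 2 := by
  have key : ∀ t : EuclideanSpace ℝ (Fin p), ⟪l, P.con u - t⟫ + ρ / 2 * ‖P.con u - t‖ ^ 2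
      = ρ / 2 * ‖P.con u + (1 / ρ) • l - t‖ ^ 2 - 1 / (2 * ρ) * ‖l‖ ^ 2 := by
    intro t
    have : P.con u + (1 / ρ) • l - t = (P.con u - t) + (1 / ρ) • l := by abel
    rw [this, norm_add_sq_real, norm_smul, inner_smul_right, real_inner_comm, mul_pow,
      Real.norm_eq_abs, sq_abs]
    field_simp
    ring
  have hp := (proj_spec P.K_nonempty P.K_closed (P.con u + (1 / ρ) • l)).2 s hs
  have hsl : P.slack ρ u l = proj P.K (P.con u + (1 / ρ) • l) := by rw [slack, if_neg hρ.ne']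
  have hsq := pow_le_pow_left₀ (norm_nonneg _) hp 2
  have := key s
  have h2 := key (P.slack ρ u l)
  rw [lagr, resid, add_assoc, add_assoc, this, h2, hsl]
  have := mul_le_mul_of_nonneg_left hsq (by positivity : 0 ≤ ρ / 2)
  linarith

end QP

end DuQuad

end

/-!
The dual function is treated as the infimum `d(λ) = inf (a + ⟪λ, r⟫)` over a set of pairs
(objective, residual). The pairs come from the points `(u, s)` with `u ∈ U` and a slack `s ∈ 𝒦`,
the slack being absent for `ρ = 0`. In both admissible situations the objective is
`1 / L_d`-strongly convex as a function of the residual: through `Q` if `Q` is positive definite,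
through the penalty if `ρ > 0` (`QP.isStrongDual`). Comparing an inexact inner solution with an
arbitrary pair through an intermediate one gives, for every `t ∈ (0, 1)`, the lower model
`d(λ) ≥ d(μ) + ⟪r, λ - μ⟫ - L_d / (2 (1 - t)) ‖λ - μ‖² - (1 - t) / t * ε_in`
(`IsStrongDual.quadratic_le`), without reference to exact inner minimizers. Everything else
follows from this inequality and from strong duality, which the Lagrange multiplier provides
(`QP.mem_dualOpt_iff`).

* With `t = 1 / 2` it gives the progress of a projected step of length `1 / (2 L_d)`
  (`IsStrongDual.step_le`). Telescoping, or the potential argument for Nesterov's sequence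
  (`fast_potential`), shows that the last dual iterate is `ε`-optimal and stays within
  about `4 R_d` of the origin (`gradient_last`, `fast_last`). For the average in the gradient
  method the starting point counts as well; its dual value is controlled because nearly optimal
  feasible points provide nearly exact dual gradients at a maximizer (`QP.Fstar_sub_le_dual_zero`).
* With `t = √ε_in / (√ε + √ε_in)` it gives, at an `ε`-optimal multiplier, that the infeasibility
  and the complementarity defect `-⟪λ, r⟫` are controlled by `√(2 L_d) (√ε + √ε_in)`
  (`IsStrongDual.norm_le_of_nearly_optimal`, `IsStrongDual.neg_inner_le_of_nearly_optimal`). The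
  directions used are the part of the residual pointing into the dual domain, and `-λ`.
  Together with strong duality this yields the primal bounds (`QP.primal_bounds`).

In the fast method the radius `4 R_d` may be exceeded, up to `4.4 R_d`, when two iterations are
made while the real number `κ` rounded up to the iteration count is close to `1`. There the
maximum in `feasBound` has a margin over the inner error (`fast_error_le`) which compensates
for it.
-/

namespace DuQuad

section AbstractDual

variable {E : Type*} [NormedAddCommGroup E] [InnerProductSpace ℝ E]

/-! ### Dual functions with an inexact gradient -/

/-- `d` is the dual function `d(λ) = inf {a + ⟪λ, r⟫ : (a, r) ∈ V}` of a set `V` of pairs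
(objective value, residual), and the objective value is `1 / L`-strongly convex as a function of
the residual: two points of `V` have, at each intermediate residual, a point of `V` below the
chord by the quadratic gap. -/
structure IsStrongDual (V : Set (ℝ × E)) (L : ℝ) (d : E → ℝ) : Prop where
  isGLB : ∀ l, IsGLB ((fun v : ℝ × E => v.1 + ⟪l, v.2⟫) '' V) (d l)
  strong : ∀ v ∈ V, ∀ w ∈ V, ∀ t : ℝ, 0 < t → t < 1 → ∃ x ∈ V,
    x.2 = (1 - t) • v.2 + t • w.2 ∧
      x.1 ≤ (1 - t) * v.1 + t * w.1 - t * (1 - t) / (2 * L) * ‖v.2 - w.2‖ ^ 2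

/-- `r` is an inexact gradient of `d` at `μ`: the residual of a point of `V` at which the
Lagrangian for the multiplier `μ` is within `e` of its infimum `d μ`. -/
def InexactGrad (V : Set (ℝ × E)) (d : E → ℝ) (e : ℝ) (μ r : E) : Prop :=
  ∃ a, (a, r) ∈ V ∧ a + ⟪μ, r⟫ ≤ d μ + e

namespace IsStrongDual

variable {V : Set (ℝ × E)} {L : ℝ} {d : E → ℝ}

theorem le_of_mem (h : IsStrongDual V L d) (l : E) {v : ℝ × E} (hv : v ∈ V) :
    d l ≤ v.1 + ⟪l, v.2⟫ :=
  (h.isGLB l).1 ⟨v, hv, rfl⟩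

theorem le_of_forall (h : IsStrongDual V L d) (l : E) {c : ℝ}
    (hc : ∀ v ∈ V, c ≤ v.1 + ⟪l, v.2⟫) : c ≤ d l :=
  (h.isGLB l).2 (by rintro _ ⟨v, hv, rfl⟩; exact hc v hv)

theorem concaveOn (h : IsStrongDual V L d) : ConcaveOn ℝ Set.univ d := by
  refine ⟨convex_univ, fun x _ y _ a b ha hb hab => ?_⟩
  refine h.le_of_forall _ fun v hv => ?_
  have hx := mul_le_mul_of_nonneg_left (h.le_of_mem x hv) ha
  have hy := mul_le_mul_of_nonneg_left (h.le_of_mem y hv) hb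
  rw [inner_add_left, inner_smul_left, inner_smul_left]
  simp only [smul_eq_mul, conj_trivial]
  calc a * d x + b * d y ≤ a * (v.1 + ⟪x, v.2⟫) + b * (v.1 + ⟪y, v.2⟫) := add_le_add hx hy
    _ = (a + b) * v.1 + (a * ⟪x, v.2⟫ + b * ⟪y, v.2⟫) := by ring
    _ = _ := by rw [hab, one_mul]

/-- An inexact gradient is an inexact supergradient. -/
theorem le_linear (h : IsStrongDual V L d) {e : ℝ} {μ r : E} (hr : InexactGrad V d e μ r)
    (l : E) : d l ≤ d μ + e + ⟪r, l - μ⟫ := by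
  obtain ⟨a, hv, ha⟩ := hr
  have := h.le_of_mem l hv
  rw [inner_sub_right, real_inner_comm l r, real_inner_comm μ r]
  linarith

/-- Smoothness of `d` along an inexact gradient. The point `v` realising the gradient is compared
with an arbitrary `w ∈ V` through the point of `V` at parameter `t` between them, where the
Lagrangian is at least `d μ`; the parameter trades the quadratic constant against the error. -/
theorem quadratic_le (h : IsStrongDual V L d) (hL : 0 < L) {e : ℝ} {μ r : E}
    (hr : InexactGrad V d e μ r) {t : ℝ} (ht0 : 0 < t) (ht1 : t < 1) (l : E) :
    d μ + ⟪r, l - μ⟫ - L / (2 * (1 - t)) * ‖l - μ‖ ^ 2 - (1 - t) / t * e ≤ d l := by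
  obtain ⟨a, hv, ha⟩ := hr
  refine h.le_of_forall l fun w hw => ?_
  obtain ⟨x, hx, hx2, hx1⟩ := h.strong _ hv w hw t ht0 ht1
  have hdx := h.le_of_mem μ hx
  rw [hx2, inner_add_right, inner_smul_right, inner_smul_right] at hdx
  simp only at hx1 hdx
  have ht1' : 0 < 1 - t := by linarith
  have hcs : ⟪r - w.2, l - μ⟫
      ≤ (1 - t) / (2 * L) * ‖r - w.2‖ ^ 2 + L / (2 * (1 - t)) * ‖l - μ‖ ^ 2 := by
    refine (real_inner_le_norm _ _).trans ?_
    have hsq : (1 - t) / (2 * L) * ‖r - w.2‖ ^ 2 + L / (2 * (1 - t)) * ‖l - μ‖ ^ 2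
        - ‖r - w.2‖ * ‖l - μ‖
        = 1 / (2 * L * (1 - t)) * ((1 - t) * ‖r - w.2‖ - L * ‖l - μ‖) ^ 2 := by
      field_simp
      ring
    have : 0 ≤ 1 / (2 * L * (1 - t)) * ((1 - t) * ‖r - w.2‖ - L * ‖l - μ‖) ^ 2 := by positivity
    linarith
  have hmid : d μ - (1 - t) / t * e + (1 - t) / (2 * L) * ‖r - w.2‖ ^ 2 ≤ w.1 + ⟪μ, w.2⟫ := by
    have h1 : t * (d μ - (1 - t) / t * e + (1 - t) / (2 * L) * ‖r - w.2‖ ^ 2)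
        ≤ t * (w.1 + ⟪μ, w.2⟫) := by
      have h2 := mul_le_mul_of_nonneg_left ha ht1'.le
      have h3 : t * (d μ - (1 - t) / t * e + (1 - t) / (2 * L) * ‖r - w.2‖ ^ 2)
          = t * d μ - (1 - t) * e + t * (1 - t) / (2 * L) * ‖r - w.2‖ ^ 2 := by
        field_simp
      rw [h3]
      linarith
    exact le_of_mul_le_mul_left h1 ht0
  have hsplit : ⟪l, w.2⟫ = ⟪μ, w.2⟫ + ⟪r, l - μ⟫ - ⟪r - w.2, l - μ⟫ := by
    rw [inner_sub_left, inner_sub_right w.2, real_inner_comm l w.2, real_inner_comm μ w.2]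
    ring
  rw [hsplit]
  linarith

theorem half_quadratic_le (h : IsStrongDual V L d) (hL : 0 < L) {e : ℝ} {μ r : E}
    (hr : InexactGrad V d e μ r) (l : E) :
    d μ + ⟪r, l - μ⟫ - L * ‖l - μ‖ ^ 2 - e ≤ d l := by
  have := h.quadratic_le hL hr (t := 1 / 2) (by norm_num) (by norm_num) l
  have h1 : L / (2 * (1 - 1 / 2)) = L := by ring
  rw [h1] at this
  linarith

/-! ### Inexact projected gradient steps -/

/-- The basic inequality of an inexact projected gradient step with step size `1 / (2 * L)`. -/
theorem step_le (h : IsStrongDual V L d) (hL : 0 < L) {e : ℝ} {μ r x w : E}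
    (hr : InexactGrad V d e μ r)
    (hx : ⟪μ + (1 / (2 * L)) • r - x, w - x⟫ ≤ 0) :
    d w - L * ‖w - μ‖ ^ 2 + L * ‖x - w‖ ^ 2 - 2 * e ≤ d x := by
  have h1 := h.half_quadratic_le hL hr x
  have h2 := h.le_linear hr w
  have h3 : ⟪r, w - μ⟫ - ⟪r, x - μ⟫ ≤ L * ‖w - μ‖ ^ 2 - L * ‖x - w‖ ^ 2 - L * ‖x - μ‖ ^ 2 := by
    have e1 : μ + (1 / (2 * L)) • r - x = (1 / (2 * L)) • r - (x - μ) := by abel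
    have e2 : w - x = (w - μ) - (x - μ) := by abel
    have e3 : ‖x - w‖ ^ 2 = ‖x - μ‖ ^ 2 - 2 * ⟪x - μ, w - μ⟫ + ‖w - μ‖ ^ 2 := by
      rw [← norm_sub_sq_real]; congr 2; abel
    rw [e1, e2, inner_sub_left, inner_sub_right _ (w - μ), inner_sub_right _ (w - μ),
      real_inner_smul_left, real_inner_smul_left, real_inner_self_eq_norm_sq] at hx
    have h4 := mul_le_mul_of_nonneg_left hx (by positivity : 0 ≤ 2 * L)
    have h5 : 2 * L * (1 / (2 * L) * ⟪r, w - μ⟫ - 1 / (2 * L) * ⟪r, x - μ⟫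
        - (⟪x - μ, w - μ⟫ - ‖x - μ‖ ^ 2))
        = ⟪r, w - μ⟫ - ⟪r, x - μ⟫ - 2 * L * (⟪x - μ, w - μ⟫ - ‖x - μ‖ ^ 2) := by
      field_simp
    rw [h5] at h4
    rw [e3]
    linarith
  linarith

/-- A step from a point of the constraint set loses at most `e` (and not `2 * e`), because the
value at the starting point enters exactly. -/
theorem sub_le_step (h : IsStrongDual V L d) (hL : 0 < L) {e : ℝ} {μ r x : E}
    (hr : InexactGrad V d e μ r)
    (hx : ⟪μ + (1 / (2 * L)) • r - x, μ - x⟫ ≤ 0) :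
    d μ - e ≤ d x := by
  have h1 := h.half_quadratic_le hL hr x
  have e1 : μ + (1 / (2 * L)) • r - x = (1 / (2 * L)) • r - (x - μ) := by abel
  have e2 : μ - x = -(x - μ) := by abel
  rw [e1, e2, inner_neg_right, inner_sub_left, real_inner_smul_left,
    real_inner_self_eq_norm_sq] at hx
  have h4 := mul_le_mul_of_nonneg_left hx (by positivity : 0 ≤ 2 * L)
  have h5 : 2 * L * -(1 / (2 * L) * ⟪r, x - μ⟫ - ‖x - μ‖ ^ 2)
      = 2 * L * ‖x - μ‖ ^ 2 - ⟪r, x - μ⟫ := by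
    field_simp
    ring
  rw [h5] at h4
  have : 0 ≤ L * ‖x - μ‖ ^ 2 := by positivity
  linarith

/-! ### From dual suboptimality to residual bounds -/

/-- At an `a²`-optimal multiplier, a `b²`-inexact gradient has small slope in every direction `v`
that keeps the multiplier in the dual domain. The parameter `t = b / (a + b)` in `quadratic_le`
balances the two errors. -/
theorem inner_le_of_nearly_optimal (h : IsStrongDual V L d) (hL : 0 < L) {a b : ℝ} (ha : 0 < a)
    (hb : 0 < b) {l r v : E} (hr : InexactGrad V d (b ^ 2) l r) (hv : d (l + v) ≤ d l + a ^ 2) :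
    ⟪r, v⟫ ≤ (a + b) * (a + L / (2 * a) * ‖v‖ ^ 2) := by
  have hab : 0 < a + b := by positivity
  have h1 := h.quadratic_le hL hr (t := b / (a + b)) (by positivity)
    (by rw [div_lt_one hab]; linarith) (l + v)
  have e1 : 1 - b / (a + b) = a / (a + b) := by field_simp; ring
  rw [e1, add_sub_cancel_left] at h1
  have e2 : L / (2 * (a / (a + b))) * ‖v‖ ^ 2 = (a + b) * (L / (2 * a) * ‖v‖ ^ 2) := by
    field_simp
  have e3 : a / (a + b) / (b / (a + b)) * b ^ 2 = a * b := by field_simp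
  rw [e2, e3] at h1
  nlinarith

/-- The part `w` of an inexact gradient that points into the dual domain is small. -/
theorem norm_le_of_nearly_optimal (h : IsStrongDual V L d) (hL : 0 < L) {a b : ℝ} (ha : 0 < a)
    (hb : 0 < b) {l r w : E} (hr : InexactGrad V d (b ^ 2) l r) (hw : ⟪r, w⟫ = ‖w‖ ^ 2)
    (hd : ∀ c : ℝ, 0 ≤ c → d (l + c • w) ≤ d l + a ^ 2) :
    ‖w‖ ≤ √(2 * L) * (a + b) := by
  rcases (norm_nonneg w).eq_or_lt with h0 | h0
  · rw [← h0]; positivity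
  have hs : 0 < √(2 * L) := by positivity
  have hs2 : √(2 * L) ^ 2 = 2 * L := Real.sq_sqrt (by positivity)
  -- the length `√(2 / L) * a` of the displacement minimises the bound
  have h1 := h.inner_le_of_nearly_optimal hL ha hb hr
    (hd (2 * a / (√(2 * L) * ‖w‖)) (by positivity))
  rw [inner_smul_right, hw, norm_smul, Real.norm_of_nonneg (by positivity)] at h1
  have e1 : 2 * a / (√(2 * L) * ‖w‖) * ‖w‖ ^ 2 = 2 * a / √(2 * L) * ‖w‖ := by field_simp
  have e2 : L / (2 * a) * (2 * a / (√(2 * L) * ‖w‖) * ‖w‖) ^ 2 = a := by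
    have : 2 * a / (√(2 * L) * ‖w‖) * ‖w‖ = 2 * a / √(2 * L) := by field_simp
    rw [this, div_pow, hs2]
    field_simp
  rw [e1, e2] at h1
  have h2 : 2 * a / √(2 * L) * ‖w‖ ≤ 2 * a / √(2 * L) * (√(2 * L) * (a + b)) := by
    refine h1.trans (le_of_eq ?_)
    field_simp
    ring
  exact le_of_mul_le_mul_left h2 (by positivity)

/-- Approximate complementary slackness: the direction `-l` is admissible for step lengths at
most `1`. For short `l` the whole step is taken. -/
theorem neg_inner_le_of_nearly_optimal (h : IsStrongDual V L d) (hL : 0 < L) {a b R : ℝ}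
    (ha : 0 < a) (hb : 0 < b) (haR : a ^ 2 ≤ 8 * L * R ^ 2) (hR : 0 < R) {l r : E}
    (hr : InexactGrad V d (b ^ 2) l r)
    (hd : ∀ c : ℝ, 0 ≤ c → c ≤ 1 → d (l + c • (-l)) ≤ d l + a ^ 2) :
    -⟪l, r⟫ ≤ max (4 * R) ‖l‖ * (√(2 * L) * (a + b)) := by
  have hs : 0 < √(2 * L) := by positivity
  have hs2 : √(2 * L) ^ 2 = 2 * L := Real.sq_sqrt (by positivity)
  by_cases hN : 2 * a / √(2 * L) ≤ ‖l‖
  · have hl : 0 < ‖l‖ := lt_of_lt_of_le (by positivity) hN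
    have h1 := h.inner_le_of_nearly_optimal hL ha hb hr
      (hd (2 * a / (√(2 * L) * ‖l‖)) (by positivity) (by
        rw [div_le_one (by positivity)]
        rwa [div_le_iff₀ hs, mul_comm ‖l‖] at hN))
    rw [inner_smul_right, norm_smul, norm_neg, Real.norm_of_nonneg (by positivity)] at h1
    have e2 : L / (2 * a) * (2 * a / (√(2 * L) * ‖l‖) * ‖l‖) ^ 2 = a := by
      have : 2 * a / (√(2 * L) * ‖l‖) * ‖l‖ = 2 * a / √(2 * L) := by field_simp
      rw [this, div_pow, hs2]
      field_simp
    rw [e2, inner_neg_right, real_inner_comm] at h1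
    have h2 : 2 * a / (√(2 * L) * ‖l‖) * -⟪l, r⟫
        ≤ 2 * a / (√(2 * L) * ‖l‖) * (‖l‖ * (√(2 * L) * (a + b))) := by
      refine h1.trans (le_of_eq ?_)
      field_simp
      ring
    have h3 := le_of_mul_le_mul_left h2 (by positivity)
    exact h3.trans (mul_le_mul_of_nonneg_right (le_max_right _ _) (by positivity))
  · push Not at hN
    have h1 := h.inner_le_of_nearly_optimal hL ha hb hr (hd 1 zero_le_one le_rfl)
    rw [one_smul, norm_neg, inner_neg_right, real_inner_comm] at h1
    have h2 : ‖l‖ ^ 2 ≤ 2 * a ^ 2 / L := by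
      have := pow_le_pow_left₀ (norm_nonneg l) hN.le 2
      rw [div_pow, hs2] at this
      refine this.trans (le_of_eq ?_)
      field_simp
    have h3 : L / (2 * a) * ‖l‖ ^ 2 ≤ a := by
      calc L / (2 * a) * ‖l‖ ^ 2 ≤ L / (2 * a) * (2 * a ^ 2 / L) := by gcongr
        _ = a := by field_simp
    have h4 : 2 * a ≤ 4 * R * √(2 * L) := by
      refine le_of_sq_le_sq ?_ (by positivity)
      rw [mul_pow (4 * R), hs2]
      nlinarith
    calc -⟪l, r⟫ ≤ (a + b) * (a + L / (2 * a) * ‖l‖ ^ 2) := h1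
      _ ≤ (a + b) * (4 * R * √(2 * L)) := by gcongr; linarith
      _ = 4 * R * (√(2 * L) * (a + b)) := by ring
      _ ≤ _ := by gcongr; exact le_max_left _ _

end IsStrongDual

end AbstractDual

/-! ### Nesterov's sequence -/

section Theta

theorem fastTheta_nonneg (k : ℕ) : 0 ≤ fastTheta k := by
  cases k with
  | zero => exact le_rfl
  | succ k => rw [fastTheta]; positivity

theorem fastTheta_sq_sub (k : ℕ) :
    fastTheta (k + 1) ^ 2 - fastTheta (k + 1) = fastTheta k ^ 2 := by
  have h : √(1 + 4 * fastTheta k ^ 2) ^ 2 = 1 + 4 * fastTheta k ^ 2 :=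
    Real.sq_sqrt (by positivity)
  rw [fastTheta]
  nlinarith

theorem fastTheta_one : fastTheta 1 = 1 := by
  simp [fastTheta]

theorem fastTheta_add_half_le (k : ℕ) : fastTheta k + 1 / 2 ≤ fastTheta (k + 1) := by
  have h : 2 * fastTheta k ≤ √(1 + 4 * fastTheta k ^ 2) := by
    apply Real.le_sqrt_of_sq_le
    nlinarith
  rw [fastTheta]
  linarith

theorem fastTheta_succ_le (k : ℕ) : fastTheta (k + 1) ≤ fastTheta k + 1 := by
  have h0 := fastTheta_nonneg k
  have h : √(1 + 4 * fastTheta k ^ 2) ≤ 1 + 2 * fastTheta k :=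
    Real.sqrt_le_iff.2 ⟨by positivity, by nlinarith⟩
  rw [fastTheta]
  linarith

theorem half_le_fastTheta (k : ℕ) : ((k : ℝ) + 2) / 2 ≤ fastTheta (k + 1) := by
  induction k with
  | zero => rw [zero_add, fastTheta_one]; norm_num
  | succ k ih =>
    have := fastTheta_add_half_le (k + 1)
    push_cast
    linarith

theorem fastTheta_le (k : ℕ) : fastTheta k ≤ k := by
  induction k with
  | zero => simp [fastTheta]
  | succ k ih =>
    have := fastTheta_succ_le k
    push_cast
    linarith

theorem one_le_fastTheta (k : ℕ) : 1 ≤ fastTheta (k + 1) := by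
  have := half_le_fastTheta k
  have : (0 : ℝ) ≤ k := Nat.cast_nonneg k
  linarith

/-- The accumulated weights `θ_1² + ⋯ + θ_k²` of the inner errors. -/
noncomputable def thetaSum (k : ℕ) : ℝ := ∑ j ∈ Finset.range k, fastTheta (j + 1) ^ 2

theorem thetaSum_succ (k : ℕ) : thetaSum (k + 1) = thetaSum k + fastTheta (k + 1) ^ 2 :=
  Finset.sum_range_succ _ _

theorem thetaSum_mono : Monotone thetaSum :=
  monotone_nat_of_le_succ fun k => by
    rw [thetaSum_succ]
    exact le_add_of_nonneg_right (sq_nonneg _)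

theorem thetaSum_one : thetaSum 1 = 1 := by
  simp [thetaSum, fastTheta_one]

theorem thetaSum_succ_le (k : ℕ) : thetaSum (k + 1) ≤ k * fastTheta (k + 1) ^ 2 + 1 := by
  induction k with
  | zero => rw [zero_add, thetaSum_one]; simp
  | succ k ih =>
    have h1 : fastTheta (k + 1) ^ 2 ≤ fastTheta (k + 2) ^ 2 :=
      pow_le_pow_left₀ (fastTheta_nonneg _) (by linarith [fastTheta_add_half_le (k + 1)]) 2
    have h2 := mul_le_mul_of_nonneg_left h1 (Nat.cast_nonneg k : (0 : ℝ) ≤ k)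
    rw [thetaSum_succ]
    push_cast
    linarith

theorem thetaSum_le (k : ℕ) : 6 * thetaSum k ≤ k * (k + 1) * (2 * k + 1) := by
  induction k with
  | zero => simp [thetaSum]
  | succ k ih =>
    have h1 : fastTheta (k + 1) ^ 2 ≤ ((k : ℝ) + 1) ^ 2 := by
      have := fastTheta_le (k + 1)
      push_cast at this
      exact pow_le_pow_left₀ (fastTheta_nonneg _) this 2
    rw [thetaSum_succ]
    push_cast
    linarith

theorem fastTheta_two_bounds : 1.61 ≤ fastTheta 2 ∧ fastTheta 2 ≤ 1.62 := by
  have h := fastTheta_sq_sub 1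
  rw [fastTheta_one] at h
  have h1 := one_le_fastTheta 1
  norm_num at h h1
  constructor <;> nlinarith

end Theta

section Convergence

variable {E : Type*} [NormedAddCommGroup E] {L : ℝ} {d : E → ℝ}

/-! ### The inexact dual gradient method -/

/-- Telescoped step inequalities of the gradient method, with a comparison point `w`. -/
theorem gradient_telescope {e : ℝ} {lam : ℕ → E} {w : E}
    (hstep : ∀ k, d w - L * ‖w - lam k‖ ^ 2 + L * ‖lam (k + 1) - w‖ ^ 2 - 2 * e ≤ d (lam (k + 1)))
    (k : ℕ) :
    k * d w - L * ‖lam 0 - w‖ ^ 2 + L * ‖lam k - w‖ ^ 2 - k * (2 * e)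
      ≤ ∑ j ∈ Finset.range k, d (lam (j + 1)) := by
  induction k with
  | zero => simp
  | succ k ih =>
    have := hstep k
    rw [norm_sub_rev w] at this
    rw [Finset.sum_range_succ]
    push_cast
    linarith

theorem gradient_dist_sq_le (hL : 0 < L) {e : ℝ} {lam : ℕ → E} {w : E}
    (hstep : ∀ k, d w - L * ‖w - lam k‖ ^ 2 + L * ‖lam (k + 1) - w‖ ^ 2 - 2 * e ≤ d (lam (k + 1)))
    (hmax : ∀ k, d (lam k) ≤ d w) (k : ℕ) :
    ‖lam k - w‖ ^ 2 ≤ ‖lam 0 - w‖ ^ 2 + k * (2 * e / L) := by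
  have h1 := gradient_telescope hstep k
  have h2 : ∑ j ∈ Finset.range k, d (lam (j + 1)) ≤ k * d w := by
    calc _ ≤ ∑ _j ∈ Finset.range k, d w := Finset.sum_le_sum fun j _ => hmax _
      _ = _ := by simp
  have h3 : L * ‖lam k - w‖ ^ 2 ≤ L * (‖lam 0 - w‖ ^ 2 + k * (2 * e / L)) := by
    have : L * (‖lam 0 - w‖ ^ 2 + k * (2 * e / L)) = L * ‖lam 0 - w‖ ^ 2 + k * (2 * e) := by
      field_simp
    linarith
  exact le_of_mul_le_mul_left h3 hL

variable [InnerProductSpace ℝ E]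

/-- Suboptimality of the average, the starting point included. -/
theorem gradient_avg (hd : ConcaveOn ℝ Set.univ d) (hL : 0 < L) {e : ℝ} {lam : ℕ → E} {w : E}
    (hstep : ∀ k, d w - L * ‖w - lam k‖ ^ 2 + L * ‖lam (k + 1) - w‖ ^ 2 - 2 * e ≤ d (lam (k + 1)))
    (h0 : d w - L * ‖lam 0 - w‖ ^ 2 ≤ d (lam 0)) (k : ℕ) :
    (k + 1) * d w - 2 * L * ‖lam 0 - w‖ ^ 2 - k * (2 * e)
      ≤ (k + 1) * d ((1 / ((k : ℝ) + 1)) • ∑ j ∈ Finset.range (k + 1), lam j) := by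
  have hk : (0 : ℝ) < k + 1 := by positivity
  have h1 := gradient_telescope hstep k
  have h2 := hd.le_map_sum (t := Finset.range (k + 1)) (w := fun _ => 1 / ((k : ℝ) + 1)) (p := lam)
    (fun _ _ => by positivity) (by simp [hk.ne']) (fun _ _ => Set.mem_univ _)
  rw [← Finset.smul_sum, ← Finset.smul_sum, smul_eq_mul, Finset.sum_range_succ'] at h2
  have h3 := mul_le_mul_of_nonneg_left h2 hk.le
  rw [← mul_assoc, mul_one_div_cancel hk.ne', one_mul] at h3
  have h4 : 0 ≤ L * ‖lam k - w‖ ^ 2 := by positivity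
  linarith

theorem norm_avg_sub_sq_le {lam : ℕ → E} {w : E} {A B : ℝ}
    (h : ∀ k : ℕ, ‖lam k - w‖ ^ 2 ≤ A + k * (2 * B)) (k : ℕ) :
    ‖(1 / ((k : ℝ) + 1)) • ∑ j ∈ Finset.range (k + 1), lam j - w‖ ^ 2 ≤ A + k * B := by
  have hk : (0 : ℝ) < k + 1 := by positivity
  have e1 : (1 / ((k : ℝ) + 1)) • ∑ j ∈ Finset.range (k + 1), lam j - w
      = (1 / ((k : ℝ) + 1)) • ∑ j ∈ Finset.range (k + 1), (lam j - w) := by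
    rw [Finset.sum_sub_distrib, smul_sub, Finset.sum_const, Finset.card_range,
      ← Nat.cast_smul_eq_nsmul ℝ, smul_smul]
    push_cast
    rw [one_div_mul_cancel hk.ne', one_smul]
  have h1 : ‖∑ j ∈ Finset.range (k + 1), (lam j - w)‖ ^ 2
      ≤ (k + 1) * ∑ j ∈ Finset.range (k + 1), ‖lam j - w‖ ^ 2 := by
    refine (pow_le_pow_left₀ (norm_nonneg _) (norm_sum_le _ _) 2).trans ?_
    have := sq_sum_le_card_mul_sum_sq (s := Finset.range (k + 1)) (f := fun j => ‖lam j - w‖)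
    rw [Finset.card_range] at this
    exact_mod_cast this
  have h2 : ∀ m : ℕ, ∑ j ∈ Finset.range (m + 1), ‖lam j - w‖ ^ 2 ≤ (m + 1) * (A + m * B) := by
    intro m
    induction m with
    | zero => simpa using h 0
    | succ m ih =>
      rw [Finset.sum_range_succ]
      have := h (m + 1)
      push_cast at this ⊢
      linarith
  rw [e1, norm_smul, mul_pow, Real.norm_of_nonneg (by positivity), div_pow, one_pow,
    one_div_mul_eq_div, div_le_iff₀ (by positivity)]
  have h3 := mul_le_mul_of_nonneg_left (h2 k) hk.le
  linarith

/-! ### The inexact dual fast gradient method -/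

/-- The auxiliary point `λ_{k-1} + θ_k (λ_k - λ_{k-1})` whose distance to the optimum enters the
potential of the fast method (it is `λ_0` for `k = 0`). -/
noncomputable def auxPoint (lam : ℕ → E) (k : ℕ) : E :=
  lam (k - 1) + fastTheta k • (lam k - lam (k - 1))

theorem auxPoint_zero (lam : ℕ → E) : auxPoint lam 0 = lam 0 := by
  simp [auxPoint]

/-- The potential of the fast method. Each step is compared with the point
`(1 - 1 / θ) λ_{k-1} + (1 / θ) w`. -/
theorem fast_potential (hd : ConcaveOn ℝ Set.univ d) {C : Set E} (hC : Convex ℝ C) {e : ℝ}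
    {lam mu : ℕ → E} {w : E} (hw : w ∈ C) (hlam : ∀ k, lam k ∈ C)
    (hstep : ∀ k, ∀ x ∈ C,
      d x - L * ‖x - mu (k + 1)‖ ^ 2 + L * ‖lam (k + 1) - x‖ ^ 2 - 2 * e ≤ d (lam (k + 1)))
    (hmu : ∀ k, fastTheta (k + 1) • mu (k + 1)
      = fastTheta (k + 1) • lam k + (fastTheta k - 1) • (lam k - lam (k - 1))) (k : ℕ) :
    fastTheta k ^ 2 * (d w - d (lam k)) + L * ‖auxPoint lam k - w‖ ^ 2
      ≤ L * ‖lam 0 - w‖ ^ 2 + 2 * e * thetaSum k := by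
  induction k with
  | zero => simp [auxPoint_zero, fastTheta, thetaSum]
  | succ k ih =>
    have hθ := one_le_fastTheta k
    have hrec := fastTheta_sq_sub k
    have hmuk := hmu k
    rw [thetaSum_succ]
    have hz : auxPoint lam (k + 1) = lam k + fastTheta (k + 1) • (lam (k + 1) - lam k) := by
      simp [auxPoint]
    set θ := fastTheta (k + 1) with hθdef
    have hθ0 : 0 < θ := by linarith
    have h1θ : 0 ≤ 1 - 1 / θ := by
      rw [sub_nonneg, div_le_one hθ0]; exact hθ
    have hsum : 1 - 1 / θ + 1 / θ = 1 := by ring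
    set x := (1 - 1 / θ) • lam k + (1 / θ) • w with hx
    have hxC : x ∈ C := hC (hlam k) hw h1θ (by positivity) hsum
    have hdx := hd.2 (Set.mem_univ (lam k)) (Set.mem_univ w) h1θ (by positivity) hsum
    rw [← hx, smul_eq_mul, smul_eq_mul] at hdx
    have hs := hstep k x hxC
    have hθx : θ • x = (θ - 1) • lam k + w := by
      rw [hx, smul_add, smul_smul, smul_smul, mul_one_div_cancel hθ0.ne', one_smul, mul_sub,
        mul_one_div_cancel hθ0.ne', mul_one]
    have e1 : θ ^ 2 * ‖x - mu (k + 1)‖ ^ 2 = ‖auxPoint lam k - w‖ ^ 2 := by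
      have : auxPoint lam k - w = -(θ • (x - mu (k + 1))) := by
        rw [smul_sub, hθx, hmuk, auxPoint]
        module
      rw [this, norm_neg, norm_smul, Real.norm_of_nonneg hθ0.le, mul_pow]
    have e2 : θ ^ 2 * ‖lam (k + 1) - x‖ ^ 2 = ‖auxPoint lam (k + 1) - w‖ ^ 2 := by
      have : auxPoint lam (k + 1) - w = θ • (lam (k + 1) - x) := by
        rw [smul_sub, hθx, hz]
        module
      rw [this, norm_smul, Real.norm_of_nonneg hθ0.le, mul_pow]
    have hm := mul_le_mul_of_nonneg_left hs (sq_nonneg θ)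
    have e3 : θ ^ 2 * (d x - L * ‖x - mu (k + 1)‖ ^ 2 + L * ‖lam (k + 1) - x‖ ^ 2 - 2 * e)
        = θ ^ 2 * d x - L * (θ ^ 2 * ‖x - mu (k + 1)‖ ^ 2)
          + L * (θ ^ 2 * ‖lam (k + 1) - x‖ ^ 2) - 2 * e * θ ^ 2 := by ring
    rw [e3, e1, e2] at hm
    have hdx' := mul_le_mul_of_nonneg_left hdx (sq_nonneg θ)
    have e4 : θ ^ 2 * ((1 - 1 / θ) * d (lam k) + 1 / θ * d w)
        = (θ ^ 2 - θ) * d (lam k) + θ * d w := by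
      field_simp
    rw [e4, hrec] at hdx'
    have e5 : θ * d w = θ ^ 2 * d w - fastTheta k ^ 2 * d w := by rw [← hrec]; ring
    linarith

/-- Each iterate is a convex combination of the previous one and of an auxiliary point. -/
theorem lam_succ_sub (lam : ℕ → E) (w : E) (k : ℕ) :
    fastTheta (k + 1) • (lam (k + 1) - w)
      = (fastTheta (k + 1) - 1) • (lam k - w) + (auxPoint lam (k + 1) - w) := by
  simp only [auxPoint, Nat.add_sub_cancel]
  module

theorem fast_norm_le (lam : ℕ → E) (w : E) {A : ℝ} {k : ℕ}
    (h : ∀ j ≤ k, ‖auxPoint lam j - w‖ ≤ A) : ‖lam k - w‖ ≤ A := by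
  induction k with
  | zero => simpa [auxPoint_zero] using h 0 le_rfl
  | succ k ih =>
    have h1 := ih fun j hj => h j (hj.trans k.le_succ)
    have hθ := one_le_fastTheta k
    have h2 : fastTheta (k + 1) * ‖lam (k + 1) - w‖ ≤ fastTheta (k + 1) * A := by
      have h3 := norm_add_le ((fastTheta (k + 1) - 1) • (lam k - w)) (auxPoint lam (k + 1) - w)
      rw [← lam_succ_sub, norm_smul, norm_smul, Real.norm_of_nonneg (by linarith),
        Real.norm_of_nonneg (by linarith)] at h3
      have h4 := mul_le_mul_of_nonneg_left h1 (by linarith : 0 ≤ fastTheta (k + 1) - 1)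
      have h5 := h (k + 1) le_rfl
      linarith
    exact le_of_mul_le_mul_left h2 (by linarith)

/-- After `⌈κ⌉` iterations the fast method is `ε`-optimal, when `ε = 8 L R² / κ²` and
`e = 2 L R² / κ³`. -/
theorem fast_rate {R e ε κ Δ N : ℝ} {k : ℕ} (hL : 0 < L) (hR : 0 < R)
    (hκ : 1 ≤ κ) (hk : k = ⌈κ⌉₊) (hε : ε * κ ^ 2 = 8 * L * R ^ 2) (he : e * κ ^ 3 = 2 * L * R ^ 2)
    (hpot : fastTheta k ^ 2 * Δ + L * N ^ 2 ≤ L * R ^ 2 + 2 * e * thetaSum k) : Δ ≤ ε := by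
  have hκ0 : 0 < κ := by linarith
  have hk1 : κ ≤ k := by rw [hk]; exact Nat.le_ceil κ
  have hk2 : (k : ℝ) < κ + 1 := by rw [hk]; exact Nat.ceil_lt_add_one hκ0.le
  obtain ⟨m, rfl⟩ : ∃ m, k = m + 1 := Nat.exists_eq_succ_of_ne_zero (by
    rintro rfl; norm_num at hk1; linarith)
  have hS := thetaSum_succ_le m
  have hθ := half_le_fastTheta m
  push_cast at hk1 hk2
  set θ := fastTheta (m + 1)
  have hm0 : (0 : ℝ) ≤ m := Nat.cast_nonneg m
  have hθ0 : 0 < θ := by linarith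
  have hθ2 : ((m : ℝ) + 2) ^ 2 ≤ 4 * θ ^ 2 := by nlinarith
  have hLR : 0 < L * R ^ 2 := by positivity
  have key : κ ^ 3 + 4 * thetaSum (m + 1) ≤ 8 * κ * θ ^ 2 := by
    rcases Nat.eq_zero_or_pos m with rfl | hm
    · have hκ1 : κ = 1 := by norm_num at hk1; linarith
      subst hκ1
      rw [zero_add, thetaSum_one]
      push_cast at hθ2
      linarith
    · have hm1 : (1 : ℝ) ≤ m := by exact_mod_cast hm
      have h1 : (m : ℝ) * θ ^ 2 ≤ κ * θ ^ 2 := by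
        have : (m : ℝ) ≤ κ := by linarith
        gcongr
      have h2 : κ ^ 2 + 4 ≤ 4 * θ ^ 2 := by nlinarith
      have h3 := mul_le_mul_of_nonneg_left h2 hκ0.le
      nlinarith
  have h1 : L * R ^ 2 * (κ ^ 3 + 4 * thetaSum (m + 1)) ≤ L * R ^ 2 * (8 * κ * θ ^ 2) :=
    mul_le_mul_of_nonneg_left key hLR.le
  have h2 : κ ^ 3 * (θ ^ 2 * Δ) ≤ κ ^ 3 * (L * R ^ 2 + 2 * e * thetaSum (m + 1)) := by
    have : 0 ≤ L * N ^ 2 := by positivity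
    exact mul_le_mul_of_nonneg_left (by linarith) (by positivity)
  have e1 : κ ^ 3 * (L * R ^ 2 + 2 * e * thetaSum (m + 1))
      = L * R ^ 2 * (κ ^ 3 + 4 * thetaSum (m + 1)) := by
    linear_combination 2 * thetaSum (m + 1) * he
  have e2 : L * R ^ 2 * (8 * κ * θ ^ 2) = κ ^ 3 * (θ ^ 2 * ε) := by
    linear_combination (-κ * θ ^ 2) * hε
  have h3 : κ ^ 3 * θ ^ 2 * Δ ≤ κ ^ 3 * θ ^ 2 * ε := by
    calc κ ^ 3 * θ ^ 2 * Δ = κ ^ 3 * (θ ^ 2 * Δ) := by ring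
      _ ≤ κ ^ 3 * (θ ^ 2 * ε) := by rw [← e2]; exact (h2.trans e1.le).trans h1
      _ = _ := by ring
  exact le_of_mul_le_mul_left h3 (by positivity)

/-- The last iterate of the fast method stays within `3 R` of the optimum, except possibly for two
iterations and `κ` close to `1`, where the slightly larger radius `3.4 R` is available. -/
theorem fast_dist {R e κ : ℝ} {k : ℕ} {lam : ℕ → E} {w : E} (hL : 0 < L) (hR : 0 < R)
    (hκ : 1 ≤ κ) (hk : k = ⌈κ⌉₊) (he : e * κ ^ 3 = 2 * L * R ^ 2)
    (hz : ∀ j, L * ‖auxPoint lam j - w‖ ^ 2 ≤ L * R ^ 2 + 2 * e * thetaSum j) :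
    ‖lam k - w‖ ≤ 3 * R ∨ (κ ≤ 1.3 ∧ ‖lam k - w‖ ≤ 3.4 * R) := by
  have hκ0 : 0 < κ := by linarith
  have hk1 : κ ≤ k := by rw [hk]; exact Nat.le_ceil κ
  have hk2 : (k : ℝ) < κ + 1 := by rw [hk]; exact Nat.ceil_lt_add_one hκ0.le
  have hκ3 : 0 < κ ^ 3 := by positivity
  have hκ31 : 1 ≤ κ ^ 3 := one_le_pow₀ hκ
  have hz' : ∀ j, ∀ c : ℝ, 0 ≤ c → κ ^ 3 + 4 * thetaSum j ≤ c ^ 2 * κ ^ 3 →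
      ‖auxPoint lam j - w‖ ≤ c * R := by
    intro j c hc hj
    refine le_of_sq_le_sq ?_ (by positivity)
    have h1 := mul_le_mul_of_nonneg_left (hz j) hκ3.le
    have h2 := mul_le_mul_of_nonneg_left hj (by positivity : 0 ≤ L * R ^ 2)
    have e1 : κ ^ 3 * (L * R ^ 2 + 2 * e * thetaSum j)
        = L * R ^ 2 * (κ ^ 3 + 4 * thetaSum j) := by
      linear_combination 2 * thetaSum j * he
    have h3 : κ ^ 3 * L * ‖auxPoint lam j - w‖ ^ 2 ≤ κ ^ 3 * L * (c * R) ^ 2 := by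
      calc κ ^ 3 * L * ‖auxPoint lam j - w‖ ^ 2 = κ ^ 3 * (L * ‖auxPoint lam j - w‖ ^ 2) := by ring
        _ ≤ L * R ^ 2 * (c ^ 2 * κ ^ 3) := (h1.trans e1.le).trans h2
        _ = _ := by ring
    exact le_of_mul_le_mul_left h3 (by positivity)
  by_cases hS : thetaSum k ≤ 2 * κ ^ 3
  · refine Or.inl (fast_norm_le lam w fun j hj => hz' j 3 (by norm_num) ?_)
    have := thetaSum_mono hj
    linarith
  · push Not at hS
    have hk2' : k = 2 := by
      by_contra hne
      have hS' := thetaSum_le k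
      have : k = 1 ∨ 3 ≤ k := by
        have : 1 ≤ k := by exact_mod_cast (hκ.trans hk1)
        omega
      rcases this with rfl | h3
      · rw [thetaSum_one] at hS
        linarith
      · have h3' : (3 : ℝ) ≤ k := by exact_mod_cast h3
        have h4 : ((k : ℝ) - 1) ^ 3 ≤ κ ^ 3 := pow_le_pow_left₀ (by linarith) (by linarith) 3
        nlinarith [mul_nonneg (sub_nonneg.2 h3') (sub_nonneg.2 h3'),
          mul_nonneg (mul_nonneg (sub_nonneg.2 h3') (sub_nonneg.2 h3')) (sub_nonneg.2 h3')]
    subst hk2'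
    obtain ⟨hθ1, hθ2⟩ := fastTheta_two_bounds
    have hrec := fastTheta_sq_sub 1
    have hS2 : thetaSum 2 = 1 + fastTheta 2 ^ 2 := by
      rw [thetaSum_succ, thetaSum_one]
    have hlam1 : auxPoint lam 1 = lam 1 := by simp [auxPoint, fastTheta_one]
    rw [fastTheta_one] at hrec
    norm_num at hrec
    have hS3 : thetaSum 2 ≤ 3.62 := by rw [hS2]; linarith
    refine Or.inr ⟨?_, ?_⟩
    · by_contra hlt
      push Not at hlt
      have : (1.3 : ℝ) ^ 3 ≤ κ ^ 3 := pow_le_pow_left₀ (by norm_num) hlt.le 3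
      norm_num at this
      linarith
    · have h1 := hz' 1 2.24 (by norm_num) (by rw [thetaSum_one]; linarith)
      have h2 := hz' 2 3.94 (by norm_num) (by linarith)
      rw [hlam1] at h1
      have h3 := norm_add_le ((fastTheta 2 - 1) • (lam 1 - w)) (auxPoint lam 2 - w)
      rw [← lam_succ_sub, norm_smul, norm_smul, Real.norm_of_nonneg (by linarith),
        Real.norm_of_nonneg (by linarith)] at h3
      have h4 := mul_le_mul_of_nonneg_left h1 (by linarith : 0 ≤ fastTheta 2 - 1)
      have h5 : fastTheta 2 * ‖lam 2 - w‖ ≤ fastTheta 2 * (3.4 * R) := by nlinarith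
      exact le_of_mul_le_mul_left h5 (by linarith)

end Convergence

/-! ### Projections, the cone and the dual domain -/

theorem inner_sub_proj_le {m : ℕ} {S : Set (EuclideanSpace ℝ (Fin m))} (hne : S.Nonempty)
    (hcl : IsClosed S) (hconv : Convex ℝ S) (x : EuclideanSpace ℝ (Fin m)) :
    ∀ w ∈ S, ⟪x - proj S x, w - proj S x⟫ ≤ 0 := by
  obtain ⟨h1, h2⟩ := proj_spec hne hcl x
  rw [← norm_eq_iInf_iff_real_inner_le_zero hconv h1]
  have : Nonempty S := ⟨⟨_, h1⟩⟩
  refine le_antisymm (le_ciInf fun w => h2 w w.2) ?_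
  exact ciInf_le (f := fun w : S => ‖x - w‖) ⟨0, by rintro _ ⟨w, rfl⟩; positivity⟩ ⟨_, h1⟩

namespace QP

variable {n p : ℕ} (P : QP n p)

theorem zero_mem_K : (0 : EuclideanSpace ℝ (Fin p)) ∈ P.K := by
  unfold K
  cases P.cone <;> simp [ConeType.toSet]

theorem K_convex : Convex ℝ P.K := by
  unfold K
  cases P.cone
  · intro x hx y hy a b ha hb _ i
    have h1 := mul_nonpos_of_nonneg_of_nonpos ha (hx i)
    have h2 := mul_nonpos_of_nonneg_of_nonpos hb (hy i)
    simpa using add_nonpos h1 h2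
  · exact convex_singleton 0

theorem zero_mem_Kd : (0 : EuclideanSpace ℝ (Fin p)) ∈ P.Kd := by
  unfold Kd
  split_ifs <;> simp

theorem Kd_convex : Convex ℝ P.Kd := by
  unfold Kd
  split_ifs
  · intro x hx y hy a b ha hb _ i
    simpa using add_nonneg (mul_nonneg ha (hx i)) (mul_nonneg hb (hy i))
  · exact convex_univ

theorem Kd_closed : IsClosed P.Kd := by
  unfold Kd
  split_ifs
  · simp only [Set.ofPred_forall]
    exact isClosed_iInter fun i => isClosed_le continuous_const (by fun_prop)
  · exact isClosed_univ

theorem dualStep_mem (ρ : ℝ) (u : EuclideanSpace ℝ (Fin n)) (μ : EuclideanSpace ℝ (Fin p)) :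
    P.dualStep ρ u μ ∈ P.Kd :=
  (proj_spec ⟨0, P.zero_mem_Kd⟩ P.Kd_closed _).1

theorem inner_dualStep_le (ρ : ℝ) (u : EuclideanSpace ℝ (Fin n))
    (μ : EuclideanSpace ℝ (Fin p)) {w : EuclideanSpace ℝ (Fin p)} (hw : w ∈ P.Kd) :
    ⟪μ + (1 / (2 * P.Ld ρ)) • P.resid ρ u μ - P.dualStep ρ u μ, w - P.dualStep ρ u μ⟫ ≤ 0 :=
  inner_sub_proj_le ⟨0, P.zero_mem_Kd⟩ P.Kd_closed P.Kd_convex _ w hw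

theorem inner_nonpos_of_mem_Kd (hQ : P.Q.PosDef) {l s : EuclideanSpace ℝ (Fin p)}
    (hl : l ∈ P.Kd) (hs : s ∈ P.K) : ⟪l, s⟫ ≤ 0 := by
  unfold Kd at hl
  unfold K at hs
  cases hc : P.cone with
  | nonpos =>
    rw [if_pos ⟨hQ, hc⟩] at hl
    rw [hc] at hs
    rw [PiLp.inner_apply]
    refine Finset.sum_nonpos fun i _ => ?_
    simpa using mul_nonpos_of_nonpos_of_nonneg (hs i) (hl i)
  | zero =>
    rw [hc] at hs
    have : s = 0 := hs
    simp [this]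

theorem mem_Kd_of_polar {l : EuclideanSpace ℝ (Fin p)} (hl : ∀ s ∈ P.K, ⟪l, s⟫ ≤ 0) :
    l ∈ P.Kd := by
  unfold Kd
  split_ifs with h
  · intro i
    have hmem : -EuclideanSpace.single i (1 : ℝ) ∈ P.K := by
      unfold K
      rw [h.2]
      intro j
      by_cases hj : j = i <;> simp [hj]
    have := hl _ hmem
    simpa [EuclideanSpace.inner_single_right] using this
  · trivial

theorem infDist_con_le_norm_sub (u : EuclideanSpace ℝ (Fin n)) {s : EuclideanSpace ℝ (Fin p)}
    (hs : s ∈ P.K) : Metric.infDist (P.con u) P.K ≤ ‖P.con u - s‖ := by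
  rw [← dist_eq_norm]
  exact Metric.infDist_le_dist_of_mem hs

/-- The component `w` of the residual that points into the dual domain: it dominates the distance
to the cone, and adding multiples of it to a multiplier keeps the multiplier in the dual domain.
It is the residual itself if the dual domain is the whole space, and its positive part if the
dual domain is the nonnegative orthant. -/
theorem exists_feasible_direction {ρ : ℝ} (hρ : P.Admissible ρ) (u : EuclideanSpace ℝ (Fin n))
    (l : EuclideanSpace ℝ (Fin p)) :
    ∃ w : EuclideanSpace ℝ (Fin p), ⟪P.resid ρ u l, w⟫ = ‖w‖ ^ 2 ∧
      Metric.infDist (P.con u) P.K ≤ ‖w‖ ∧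
      ∀ l' ∈ P.Kd, ∀ c : ℝ, 0 ≤ c → l' + c • w ∈ P.Kd := by
  by_cases h : P.Q.PosDef ∧ P.cone = ConeType.nonpos
  · have hρ0 : ρ = 0 := by
      rcases hρ with h1 | h1
      · exact h1.2
      · exact absurd h.1 h1.1
    have hr : P.resid ρ u l = P.con u := by simp [resid, slack, hρ0]
    rw [hr]
    set r := P.con u with hrdef
    refine ⟨WithLp.toLp 2 fun i => max (r i) 0, ?_, ?_, ?_⟩
    · rw [EuclideanSpace.norm_sq_eq, PiLp.inner_apply]
      refine Finset.sum_congr rfl fun i _ => ?_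
      rcases le_total (r i) 0 with hi | hi <;> simp [hi, sq]
    · have hs : (WithLp.toLp 2 fun i => min (r i) 0 : EuclideanSpace ℝ (Fin p)) ∈ P.K := by
        unfold K
        rw [h.2]
        intro i
        simp
      refine (P.infDist_con_le_norm_sub u hs).trans (le_of_eq ?_)
      congr 1
      ext i
      rcases le_total (r i) 0 with hi | hi <;> simp [← hrdef, hi]
    · intro l' hl' c hc
      unfold Kd at hl' ⊢
      rw [if_pos h] at hl' ⊢
      intro i
      have := mul_nonneg hc (le_max_right (r i) 0)
      simpa using add_nonneg (hl' i) this
  · refine ⟨P.resid ρ u l, real_inner_self_eq_norm_sq _, ?_, ?_⟩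
    · refine P.infDist_con_le_norm_sub u (s := P.slack ρ u l) ?_
      rcases hρ with h1 | h1
      · rw [slack, if_pos h1.2]
        exact P.zero_mem_K
      · exact P.slack_mem h1.2 u l
    · intro l' _ c _
      unfold Kd
      rw [if_neg h]
      trivial

/-! ### The smallest eigenvalue -/

theorem lamMin_le_eigenvalues (i : Fin n) : P.lamMin ≤ P.Q_posSemidef.1.eigenvalues i := by
  unfold lamMin
  rw [P.Q_posSemidef.1.spectrum_real_eq_range_eigenvalues]
  exact csInf_le (Set.finite_range _).bddBelow ⟨i, rfl⟩

theorem lamMin_nonneg : 0 ≤ P.lamMin := by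
  unfold lamMin
  rw [P.Q_posSemidef.1.spectrum_real_eq_range_eigenvalues]
  refine Real.sInf_nonneg ?_
  rintro _ ⟨i, rfl⟩
  exact P.Q_posSemidef.eigenvalues_nonneg i

theorem lamMin_eq_zero (h : ¬ P.Q.PosDef) : P.lamMin = 0 := by
  rw [P.Q_posSemidef.1.posDef_iff_eigenvalues_pos] at h
  push Not at h
  obtain ⟨i, hi⟩ := h
  exact le_antisymm ((P.lamMin_le_eigenvalues i).trans hi) P.lamMin_nonneg

theorem Q_symm (x y : EuclideanSpace ℝ (Fin n)) :
    ⟪Matrix.toEuclideanLin P.Q x, y⟫ = ⟪x, Matrix.toEuclideanLin P.Q y⟫ :=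
  Matrix.isSymmetric_toEuclideanLin_iff.2 P.Q_posSemidef.1 x y

theorem lamMin_mul_le (w : EuclideanSpace ℝ (Fin n)) :
    P.lamMin * ‖w‖ ^ 2 ≤ ⟪w, Matrix.toEuclideanLin P.Q w⟫ := by
  set b := P.Q_posSemidef.1.eigenvectorBasis
  have hb : ∀ i, Matrix.toEuclideanLin P.Q (b i) = P.Q_posSemidef.1.eigenvalues i • b i := by
    intro i
    have := P.Q_posSemidef.1.mulVec_eigenvectorBasis i
    rw [Matrix.toLpLin_apply, this]
    rfl
  rw [← b.sum_inner_mul_inner w (Matrix.toEuclideanLin P.Q w), ← b.sum_sq_norm_inner_right,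
    Finset.mul_sum]
  refine Finset.sum_le_sum fun i _ => ?_
  rw [← P.Q_symm, hb, real_inner_smul_left, real_inner_comm, Real.norm_eq_abs, sq_abs]
  have := mul_le_mul_of_nonneg_right (P.lamMin_le_eigenvalues i) (sq_nonneg ⟪w, b i⟫)
  linarith

theorem norm_G_le (w : EuclideanSpace ℝ (Fin n)) :
    ‖Matrix.toEuclideanLin P.G w‖ ≤ P.normG * ‖w‖ :=
  (Matrix.toEuclideanLin P.G).toContinuousLinearMap.le_opNorm w

/-! ### The dual of the quadratic program -/

/-- The pairs (objective, residual) of the problem `min F(u) + ρ/2 ‖G u + g - s‖²` subject to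
`G u + g - s = 0`, `u ∈ U` and `s ∈ 𝒦`, where the slack `s` is absent for `ρ = 0`. -/
def valueSet (ρ : ℝ) : Set (ℝ × EuclideanSpace ℝ (Fin p)) :=
  {v | ∃ u ∈ P.U, ∃ s ∈ P.K, (ρ = 0 → s = 0) ∧
    v = (P.F u + ρ / 2 * ‖P.con u - s‖ ^ 2, P.con u - s)}

theorem F_continuous : Continuous P.F := by
  unfold F
  have h : Continuous (Matrix.toEuclideanLin P.Q) := LinearMap.continuous_of_finiteDimensional _
  fun_prop

theorem con_continuous : Continuous P.con := by
  unfold con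
  have h : Continuous (Matrix.toEuclideanLin P.G) := LinearMap.continuous_of_finiteDimensional _
  fun_prop

theorem bddBelow_lagrangian (l : EuclideanSpace ℝ (Fin p)) :
    BddBelow ((fun u => P.F u + ⟪l, P.con u⟫) '' P.U) := by
  have h1 := P.F_continuous
  have h2 := P.con_continuous
  exact (P.U_compact.image (by fun_prop)).bddBelow

theorem bddBelow_F : BddBelow (P.F '' P.U) :=
  (P.U_compact.image P.F_continuous).bddBelow

theorem bddBelow_lagr {ρ : ℝ} (hρ : 0 ≤ ρ) (l : EuclideanSpace ℝ (Fin p)) :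
    BddBelow ((fun u => P.lagr ρ u l) '' P.U) := by
  rcases hρ.eq_or_lt with rfl | hρ
  · simp only [lagr_zero]
    exact P.bddBelow_lagrangian l
  · obtain ⟨c, hc⟩ := P.bddBelow_F
    refine ⟨c - 1 / (2 * ρ) * ‖l‖ ^ 2, ?_⟩
    rintro _ ⟨u, hu, rfl⟩
    have h1 : c ≤ P.F u := hc ⟨u, hu, rfl⟩
    simp only [lagr]
    set r := P.resid ρ u l
    have h2 : ⟪l, r⟫ + ρ / 2 * ‖r‖ ^ 2 + 1 / (2 * ρ) * ‖l‖ ^ 2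
        = 1 / (2 * ρ) * ‖l + ρ • r‖ ^ 2 := by
      rw [norm_add_sq_real, norm_smul, inner_smul_right, mul_pow, Real.norm_eq_abs, sq_abs]
      field_simp
      ring
    have h3 : 0 ≤ 1 / (2 * ρ) * ‖l + ρ • r‖ ^ 2 := by positivity
    linarith

theorem Admissible.nonneg {P : QP n p} {ρ : ℝ} (h : P.Admissible ρ) : 0 ≤ ρ := by
  rcases h with h | h
  · exact h.2.ge
  · exact h.2.le

theorem resid_mem_valueSet {ρ : ℝ} (hρ : 0 ≤ ρ) {u : EuclideanSpace ℝ (Fin n)} (hu : u ∈ P.U)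
    (l : EuclideanSpace ℝ (Fin p)) :
    (P.F u + ρ / 2 * ‖P.resid ρ u l‖ ^ 2, P.resid ρ u l) ∈ P.valueSet ρ := by
  refine ⟨u, hu, P.slack ρ u l, ?_, fun h => by simp [slack, h], rfl⟩
  rcases hρ.eq_or_lt with rfl | hρ
  · simpa [slack] using P.zero_mem_K
  · exact P.slack_mem hρ u l

theorem lagr_eq (ρ : ℝ) (u : EuclideanSpace ℝ (Fin n)) (l : EuclideanSpace ℝ (Fin p)) :
    P.F u + ρ / 2 * ‖P.resid ρ u l‖ ^ 2 + ⟪l, P.resid ρ u l⟫ = P.lagr ρ u l := by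
  rw [lagr]; ring

theorem InnerSol.inexactGrad {P : QP n p} {ρ : ℝ} (hρ : 0 ≤ ρ) {e : ℝ}
    {μ : EuclideanSpace ℝ (Fin p)} {u : EuclideanSpace ℝ (Fin n)} (h : P.InnerSol ρ e μ u) :
    InexactGrad (P.valueSet ρ) (P.dual ρ) e μ (P.resid ρ u μ) := by
  refine ⟨_, P.resid_mem_valueSet hρ h.1 μ, ?_⟩
  rw [lagr_eq]
  linarith [h.2.2]

theorem isGLB_dual {ρ : ℝ} (hρ : 0 ≤ ρ) (hU : P.U.Nonempty) (l : EuclideanSpace ℝ (Fin p)) :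
    IsGLB ((fun v : ℝ × EuclideanSpace ℝ (Fin p) => v.1 + ⟪l, v.2⟫) '' P.valueSet ρ)
      (P.dual ρ l) := by
  constructor
  · rintro _ ⟨_, ⟨u, hu, s, hs, hs0, rfl⟩, rfl⟩
    refine (csInf_le (P.bddBelow_lagr hρ l) ⟨u, hu, rfl⟩).trans ?_
    simp only
    rcases hρ.eq_or_lt with rfl | hρ
    · simp [hs0 rfl, lagr_zero]
    · linarith [P.lagr_le hρ u l s hs]
  · intro c hc
    refine le_csInf (hU.image _) ?_
    rintro _ ⟨u, hu, rfl⟩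
    simp only
    rw [← lagr_eq]
    exact hc ⟨_, P.resid_mem_valueSet hρ hu l, rfl⟩

theorem F_combo (u v : EuclideanSpace ℝ (Fin n)) (t : ℝ) :
    P.F ((1 - t) • u + t • v) = (1 - t) * P.F u + t * P.F v
      - t * (1 - t) / 2 * ⟪u - v, Matrix.toEuclideanLin P.Q (u - v)⟫ := by
  have h := P.Q_symm u v
  rw [real_inner_comm] at h
  simp only [F, map_add, map_smul, map_sub, inner_add_left, inner_add_right, inner_sub_left,
    inner_sub_right, real_inner_smul_left, real_inner_smul_right]
  rw [h]
  ring

theorem norm_combo_sq {E : Type*} [NormedAddCommGroup E] [InnerProductSpace ℝ E] (u v : E)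
    (t : ℝ) : ‖(1 - t) • u + t • v‖ ^ 2
      = (1 - t) * ‖u‖ ^ 2 + t * ‖v‖ ^ 2 - t * (1 - t) * ‖u - v‖ ^ 2 := by
  simp only [← real_inner_self_eq_norm_sq, inner_add_left, inner_add_right, inner_sub_left,
    inner_sub_right, real_inner_smul_left, real_inner_smul_right, real_inner_comm u v]
  ring

/-- The curvature of the (augmented) objective along a displacement `x` of `u` and `y` of the
slack dominates the residual: through `Q` if `Q` is positive definite, through the penalty
otherwise. -/
theorem curvature {ρ : ℝ} (hρ : P.Admissible ρ) (hL : 0 < P.Ld ρ) (x : EuclideanSpace ℝ (Fin n))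
    (y : EuclideanSpace ℝ (Fin p)) (hy : ρ = 0 → y = 0) :
    1 / P.Ld ρ * ‖Matrix.toEuclideanLin P.G x - y‖ ^ 2
      ≤ ⟪x, Matrix.toEuclideanLin P.Q x⟫ + ρ * ‖Matrix.toEuclideanLin P.G x - y‖ ^ 2 := by
  have hG : 0 < P.normG ^ 2 := by
    refine (sq_nonneg _).lt_of_ne fun h => ?_
    rw [Ld, ← h, zero_div] at hL
    exact lt_irrefl _ hL
  have hG0 : P.normG ≠ 0 := fun h => by simp [h] at hG
  have hx := P.lamMin_mul_le x
  have hx0 : 0 ≤ P.lamMin * ‖x‖ ^ 2 := mul_nonneg P.lamMin_nonneg (sq_nonneg _)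
  rcases hρ with ⟨_, rfl⟩ | ⟨hQ, hρ⟩
  · rw [hy rfl, sub_zero, Ld, one_div_div]
    have h1 := pow_le_pow_left₀ (norm_nonneg _) (P.norm_G_le x) 2
    have h2 : (P.lamMin + 0 * P.normG ^ 2) / P.normG ^ 2 * ‖Matrix.toEuclideanLin P.G x‖ ^ 2
        ≤ (P.lamMin + 0 * P.normG ^ 2) / P.normG ^ 2 * (P.normG * ‖x‖) ^ 2 :=
      mul_le_mul_of_nonneg_left h1 (div_nonneg (by linarith [P.lamMin_nonneg]) hG.le)
    have h3 : (P.lamMin + 0 * P.normG ^ 2) / P.normG ^ 2 * (P.normG * ‖x‖) ^ 2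
        = P.lamMin * ‖x‖ ^ 2 := by
      rw [mul_pow, zero_mul, add_zero]
      field_simp
    linarith
  · have h1 : 1 / P.Ld ρ = ρ := by
      rw [Ld, P.lamMin_eq_zero hQ]
      field_simp
      ring
    rw [h1]
    linarith

theorem isStrongDual {ρ : ℝ} (hρ : P.Admissible ρ) (hL : 0 < P.Ld ρ) (hU : P.U.Nonempty) :
    IsStrongDual (P.valueSet ρ) (P.Ld ρ) (P.dual ρ) := by
  refine ⟨P.isGLB_dual hρ.nonneg hU, ?_⟩
  rintro _ ⟨u, hu, s, hs, hs0, rfl⟩ _ ⟨v, hv, s', hs', hs0', rfl⟩ t ht0 ht1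
  have hcon : P.con ((1 - t) • u + t • v) - ((1 - t) • s + t • s')
      = (1 - t) • (P.con u - s) + t • (P.con v - s') := by
    simp only [con, map_add, map_smul]
    module
  refine ⟨_, ⟨(1 - t) • u + t • v,
    P.U_convex hu hv (by linarith) ht0.le (by ring), (1 - t) • s + t • s',
    P.K_convex hs hs' (by linarith) ht0.le (by ring),
    fun h => by simp [hs0 h, hs0' h], rfl⟩, hcon, ?_⟩
  simp only
  have hdiff : P.con u - s - (P.con v - s')
      = Matrix.toEuclideanLin P.G (u - v) - (s - s') := by
    simp only [con, map_sub]
    abel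
  have hc := P.curvature hρ hL (u - v) (s - s') fun h => by simp [hs0 h, hs0' h]
  rw [← hdiff] at hc
  rw [hcon, F_combo, norm_combo_sq]
  have h1 := mul_le_mul_of_nonneg_left hc
    (div_nonneg (mul_nonneg ht0.le (sub_nonneg.2 ht1.le)) zero_le_two)
  have h2 : t * (1 - t) / 2 * (1 / P.Ld ρ * ‖P.con u - s - (P.con v - s')‖ ^ 2)
      = t * (1 - t) / (2 * P.Ld ρ) * ‖P.con u - s - (P.con v - s')‖ ^ 2 := by
    field_simp
  rw [h2] at h1
  linarith

/-! ### Strong duality -/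

/-- A feasible point gives a pair whose residual has a nonpositive product with every multiplier
of the dual domain, and whose objective value is the one of the quadratic program. -/
theorem exists_mem_valueSet_of_feasible {ρ : ℝ} (hρ : P.Admissible ρ)
    {u : EuclideanSpace ℝ (Fin n)} (hu : u ∈ P.feasible) :
    ∃ r, (P.F u, r) ∈ P.valueSet ρ ∧ ∀ l ∈ P.Kd, ⟪l, r⟫ ≤ 0 := by
  rcases hρ with ⟨hQ, rfl⟩ | ⟨hQ, hρ⟩
  · exact ⟨P.con u, ⟨u, hu.1, 0, P.zero_mem_K, fun _ => rfl, by simp⟩,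
      fun l hl => P.inner_nonpos_of_mem_Kd hQ hl hu.2⟩
  · exact ⟨0, ⟨u, hu.1, P.con u, hu.2, fun h => absurd h hρ.ne', by simp⟩, fun l _ => by simp⟩

theorem dual_le_Fstar {ρ : ℝ} (hρ : P.Admissible ρ) (hfeas : P.feasible.Nonempty)
    {l : EuclideanSpace ℝ (Fin p)} (hl : l ∈ P.Kd) : P.dual ρ l ≤ P.Fstar := by
  obtain ⟨u0, hu0⟩ := hfeas
  refine le_csInf ⟨_, u0, hu0, rfl⟩ ?_
  rintro _ ⟨u, hu, rfl⟩
  obtain ⟨r, hr, hlr⟩ := P.exists_mem_valueSet_of_feasible hρ hu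
  have := (P.isGLB_dual hρ.nonneg ⟨u0, hu0.1⟩ l).1 ⟨_, hr, rfl⟩
  simp only at this
  linarith [hlr l hl]

theorem Fstar_le_dual_of_multiplier {ρ : ℝ} (hρ : 0 ≤ ρ) (hU : P.U.Nonempty)
    {l : EuclideanSpace ℝ (Fin p)} (hl : P.IsLagrangeMultiplier l) : P.Fstar ≤ P.dual ρ l := by
  refine (P.isGLB_dual hρ hU l).2 ?_
  rintro _ ⟨_, ⟨u, hu, s, hs, _, rfl⟩, rfl⟩
  have h1 := csInf_le (P.bddBelow_lagrangian l) ⟨u, hu, rfl⟩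
  rw [hl.2] at h1
  have h2 := hl.1 s hs
  have h3 : 0 ≤ ρ / 2 * ‖P.con u - s‖ ^ 2 := by positivity
  simp only [inner_sub_right] at h1 ⊢
  linarith

/-- The maximizers of the (augmented) dual function are the multipliers at which it attains the
primal optimal value. -/
theorem mem_dualOpt_iff {ρ : ℝ} (hρ : P.Admissible ρ) (hfeas : P.feasible.Nonempty)
    (hmult : ∃ l, P.IsLagrangeMultiplier l) (l : EuclideanSpace ℝ (Fin p)) :
    l ∈ P.dualOpt ρ ↔ l ∈ P.Kd ∧ P.dual ρ l = P.Fstar := by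
  have hU : P.U.Nonempty := hfeas.mono fun _ h => h.1
  constructor
  · rintro ⟨hl, hmax⟩
    obtain ⟨l', hl'⟩ := hmult
    exact ⟨hl, le_antisymm (P.dual_le_Fstar hρ hfeas hl)
      ((P.Fstar_le_dual_of_multiplier hρ.nonneg hU hl').trans
        (hmax l' (P.mem_Kd_of_polar hl'.1)))⟩
  · rintro ⟨hl, heq⟩
    exact ⟨hl, fun l' hl' => heq ▸ P.dual_le_Fstar hρ hfeas hl'⟩

theorem exists_norm_eq_Rd {ρ : ℝ} (hρ : P.Admissible ρ) (hfeas : P.feasible.Nonempty)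
    (hmult : ∃ l, P.IsLagrangeMultiplier l) :
    ∃ l ∈ P.Kd, P.dual ρ l = P.Fstar ∧ ‖l‖ = P.Rd ρ 0 := by
  have hU : P.U.Nonempty := hfeas.mono fun _ h => h.1
  have hset : P.dualOpt ρ = P.Kd ∩ ⋂ v ∈ P.valueSet ρ, {l | P.Fstar ≤ v.1 + ⟪l, v.2⟫} := by
    ext l
    rw [P.mem_dualOpt_iff hρ hfeas hmult, Set.mem_inter_iff]
    refine and_congr_right fun hl => ?_
    simp only [Set.mem_iInter]
    constructor
    · intro h v hv
      exact h ▸ (P.isGLB_dual hρ.nonneg hU l).1 ⟨v, hv, rfl⟩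
    · intro h
      refine le_antisymm (P.dual_le_Fstar hρ hfeas hl) ((P.isGLB_dual hρ.nonneg hU l).2 ?_)
      rintro _ ⟨v, hv, rfl⟩
      exact h v hv
  have hcl : IsClosed (P.dualOpt ρ) := by
    rw [hset]
    exact P.Kd_closed.inter (isClosed_biInter fun v _ =>
      isClosed_le continuous_const (by fun_prop))
  have hne : (P.dualOpt ρ).Nonempty := by
    obtain ⟨l, hl⟩ := hmult
    have hlK := P.mem_Kd_of_polar hl.1
    exact ⟨l, (P.mem_dualOpt_iff hρ hfeas ⟨l, hl⟩ l).2 ⟨hlK,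
      le_antisymm (P.dual_le_Fstar hρ hfeas hlK)
        (P.Fstar_le_dual_of_multiplier hρ.nonneg hU hl)⟩⟩
  obtain ⟨l, hl, hdist⟩ := hcl.exists_infDist_eq_dist hne 0
  obtain ⟨h1, h2⟩ := (P.mem_dualOpt_iff hρ hfeas hmult l).1 hl
  exact ⟨l, h1, h2, by rw [Rd, hdist, dist_zero_left]⟩

/-- The dual function at `0` is above the quadratic model at a maximizer `l` without a linear
term: nearly optimal feasible points give nearly exact gradients at `l`, and these have a
nonpositive product with `l`. -/
theorem Fstar_sub_le_dual_zero {ρ : ℝ} (hρ : P.Admissible ρ) (hL : 0 < P.Ld ρ)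
    (hfeas : P.feasible.Nonempty) {l : EuclideanSpace ℝ (Fin p)} (hl : l ∈ P.Kd)
    (hopt : P.dual ρ l = P.Fstar) : P.Fstar - P.Ld ρ * ‖l‖ ^ 2 ≤ P.dual ρ 0 := by
  refine le_of_forall_pos_sub_le fun δ hδ => ?_
  obtain ⟨_, ⟨u, hu, rfl⟩, hlt⟩ := exists_lt_of_csInf_lt (hfeas.image P.F)
    (lt_add_of_pos_right P.Fstar hδ)
  obtain ⟨r, hr, hlr⟩ := P.exists_mem_valueSet_of_feasible hρ hu
  have hgrad : InexactGrad (P.valueSet ρ) (P.dual ρ) δ l r :=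
    ⟨_, hr, by linarith [hlr l hl]⟩
  have h := (P.isStrongDual hρ hL ⟨u, hu.1⟩).half_quadratic_le hL hgrad 0
  rw [zero_sub, inner_neg_right, norm_neg, real_inner_comm, hopt] at h
  linarith [hlr l hl]

/-- Lower bound for the objective value of an infeasible point. -/
theorem Fstar_sub_F_le {ρ : ℝ} (hρ : P.Admissible ρ) {l : EuclideanSpace ℝ (Fin p)}
    (hl : l ∈ P.Kd) (hopt : P.dual ρ l = P.Fstar) {u : EuclideanSpace ℝ (Fin n)} (hu : u ∈ P.U) :
    P.Fstar - P.F u ≤ ‖l‖ * Metric.infDist (P.con u) P.K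
      + ρ / 2 * Metric.infDist (P.con u) P.K ^ 2 := by
  obtain ⟨s, hs, hdist⟩ := P.K_closed.exists_infDist_eq_dist P.K_nonempty (P.con u)
  rw [hdist, dist_eq_norm]
  have hcs := real_inner_le_norm l (P.con u - s)
  rcases hρ with ⟨hQ, rfl⟩ | ⟨hQ, hρ⟩
  · have h := (P.isGLB_dual le_rfl ⟨u, hu⟩ l).1
      ⟨_, ⟨u, hu, 0, P.zero_mem_K, fun _ => rfl, rfl⟩, rfl⟩
    simp only [zero_div, zero_mul, add_zero, sub_zero] at h ⊢
    have hls := P.inner_nonpos_of_mem_Kd hQ hl hs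
    rw [inner_sub_right] at hcs
    linarith
  · have h := (P.isGLB_dual hρ.le ⟨u, hu⟩ l).1
      ⟨_, ⟨u, hu, s, hs, fun h => absurd h hρ.ne', rfl⟩, rfl⟩
    simp only at h
    linarith

theorem rho_le {ρ : ℝ} (hρ : P.Admissible ρ) (hL : 0 < P.Ld ρ) : ρ ≤ 1 / P.Ld ρ := by
  rcases hρ with ⟨_, rfl⟩ | ⟨hQ, hρ⟩
  · positivity
  · have hG : P.normG ≠ 0 := by
      rintro h
      rw [Ld, h] at hL
      norm_num at hL
    rw [Ld, P.lamMin_eq_zero hQ]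
    refine le_of_eq ?_
    field_simp
    ring

end QP

/-! ### The bound `feasBound` -/

section Numerics

variable {ε L R : ℝ}

theorem sqrt_two_mul_le (hL : 0 < L) (hR : 0 < R) (h : ε ≤ 8 * L * R ^ 2) :
    √(2 * L) * √ε ≤ 4 * L * R := by
  rw [← Real.sqrt_mul (by positivity)]
  exact Real.sqrt_le_iff.2 ⟨by positivity, by nlinarith⟩

/-- The second entry of the maximum in `feasBound`, squared. -/
theorem fast_term_sq (hε : 0 < ε) (hL : 0 < L) (hR : 0 < R) :
    (L ^ (1 / 4 : ℝ) / √(3 * R) * ε ^ (3 / 4 : ℝ)) ^ 2 = √L * (ε * √ε) / (3 * R) := by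
  have h1 : (L ^ (1 / 4 : ℝ)) ^ 2 = √L := by
    rw [← Real.rpow_natCast, ← Real.rpow_mul hL.le, Real.sqrt_eq_rpow]
    norm_num
  have h2 : (ε ^ (3 / 4 : ℝ)) ^ 2 = ε * √ε := by
    rw [← Real.rpow_natCast, ← Real.rpow_mul hε.le, Real.sqrt_eq_rpow]
    nth_rw 2 [← Real.rpow_one ε]
    rw [← Real.rpow_add hε]
    norm_num
  rw [mul_pow, div_pow, h1, h2, Real.sq_sqrt (by positivity)]
  ring

theorem feasBound_le (hε : 0 < ε) (hL : 0 < L) (hR : 0 < R) (h : ε ≤ 8 * L * R ^ 2) :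
    feasBound ε L R ≤ 2.4 * (√L * √ε) := by
  have hp : 0 < √L * √ε := by positivity
  have hsL : √L ^ 2 = L := Real.sq_sqrt hL.le
  have hsε : √ε ^ 2 = ε := Real.sq_sqrt hε.le
  have h2 : (1.414 : ℝ) ≤ √2 := Real.le_sqrt_of_sq_le (by norm_num)
  have h2' : √2 ≤ (1.415 : ℝ) := Real.sqrt_le_iff.2 ⟨by norm_num, by norm_num⟩
  have e1 : √(2 * L * ε) = √2 * (√L * √ε) := by
    rw [Real.sqrt_mul (by positivity), Real.sqrt_mul (by positivity), mul_assoc]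
  have hmax : max (√(L * ε) / √2) (L ^ (1 / 4 : ℝ) / √(3 * R) * ε ^ (3 / 4 : ℝ))
      ≤ 0.98 * (√L * √ε) := by
    refine max_le ?_ ?_
    · rw [Real.sqrt_mul hL.le, div_le_iff₀ (by positivity)]
      nlinarith
    · refine le_of_sq_le_sq ?_ (by positivity)
      rw [fast_term_sq hε hL hR, div_le_iff₀ (by positivity)]
      have h3 := sqrt_two_mul_le hL hR h
      rw [Real.sqrt_mul zero_le_two] at h3
      have h4 : √ε ≤ 4 / 1.414 * √L * R := by
        have : √L * (1.414 * √ε) ≤ √L * (4 * √L * R) := by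
          calc √L * (1.414 * √ε) = 1.414 * (√L * √ε) := by ring
            _ ≤ √2 * (√L * √ε) := by gcongr
            _ ≤ 4 * L * R := by linarith
            _ = _ := by rw [← hsL, Real.sqrt_sq (Real.sqrt_nonneg _)]; ring
        have := le_of_mul_le_mul_left this (by positivity)
        linarith
      calc √L * (ε * √ε) ≤ √L * (ε * (4 / 1.414 * √L * R)) := by gcongr
        _ = 4 / 1.414 * R * (√L ^ 2 * ε) := by ring
        _ ≤ 0.98 ^ 2 * 3 * R * (√L ^ 2 * ε) := by gcongr; norm_num
        _ = _ := by rw [mul_pow, mul_pow, hsε]; ring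
  rw [feasBound, e1]
  nlinarith

theorem gradient_le_feasBound (hε : 0 < ε) (hL : 0 < L) :
    √(2 * L) * (√ε + √(ε / 4)) ≤ feasBound ε L R := by
  have h1 : √(2 * L) * √ε = √(2 * L * ε) := (Real.sqrt_mul (by positivity) _).symm
  have h2 : √(2 * L) * √(ε / 4) = √(L * ε) / √2 := by
    rw [← Real.sqrt_mul (by positivity), ← Real.sqrt_div (by positivity)]
    congr 1
    ring
  rw [mul_add, h1, h2, feasBound, add_comm]
  gcongr
  exact le_max_left _ _

/-- The maximum in `feasBound` leaves a margin over the contribution of the inner error. -/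
theorem fast_error_le (hε : 0 < ε) (hL : 0 < L) (hR : 0 < R) :
    √(2 * L) * √ε + 1.37 * (√(2 * L) * √(ε * √ε / (8 * R * √(2 * L)))) ≤ feasBound ε L R := by
  have h1 : √(2 * L) * √ε = √(2 * L * ε) := (Real.sqrt_mul (by positivity) _).symm
  have h2 : 1.37 * (√(2 * L) * √(ε * √ε / (8 * R * √(2 * L))))
      ≤ L ^ (1 / 4 : ℝ) / √(3 * R) * ε ^ (3 / 4 : ℝ) := by
    refine le_of_sq_le_sq ?_ (by positivity)
    rw [fast_term_sq hε hL hR, mul_pow, mul_pow, Real.sq_sqrt (by positivity),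
      Real.sq_sqrt (by positivity)]
    have hs2 : √2 ≤ (1.4143 : ℝ) := Real.sqrt_le_iff.2 ⟨by norm_num, by norm_num⟩
    have e1 : 2 * L * (ε * √ε / (8 * R * √(2 * L))) = √2 * (√L * (ε * √ε) / (8 * R)) := by
      have : 2 * L = √(2 * L) * √(2 * L) := (Real.mul_self_sqrt (by positivity)).symm
      have h3 : √(2 * L) = √2 * √L := Real.sqrt_mul zero_le_two _
      have h4 : 0 < √(2 * L) := by positivity
      calc 2 * L * (ε * √ε / (8 * R * √(2 * L)))
          = √(2 * L) * √(2 * L) * (ε * √ε / (8 * R * √(2 * L))) := by rw [← this]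
        _ = √(2 * L) * (ε * √ε) / (8 * R) := by field_simp
        _ = _ := by rw [h3]; ring
    rw [e1]
    have hX : 0 ≤ √L * (ε * √ε) / (8 * R) := by positivity
    calc 1.37 ^ 2 * (√2 * (√L * (ε * √ε) / (8 * R)))
        ≤ 1.37 ^ 2 * (1.4143 * (√L * (ε * √ε) / (8 * R))) := by gcongr
      _ ≤ 8 / 3 * (√L * (ε * √ε) / (8 * R)) := by nlinarith
      _ = _ := by field_simp
  rw [h1, feasBound, add_comm]
  gcongr
  exact h2.trans (le_max_right _ _)

end Numerics

/-! ### Bounds for the last primal iterate -/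

namespace QP

variable {n p : ℕ} (P : QP n p)

theorem Ld_nonneg {ρ : ℝ} (hρ : P.Admissible ρ) : 0 ≤ P.Ld ρ :=
  div_nonneg (sq_nonneg _)
    (add_nonneg P.lamMin_nonneg (mul_nonneg hρ.nonneg (sq_nonneg _)))

/-- An inexact inner solution at an `ε`-optimal multiplier is nearly feasible and nearly optimal.
The suboptimality bound needs the multiplier to be bounded; the number `B` only has to dominate
the two bounds obtained from near optimality. -/
theorem primal_bounds {ρ ε e B : ℝ} (hρ : P.Admissible ρ) (hfeas : P.feasible.Nonempty)
    (hmult : ∃ l, P.IsLagrangeMultiplier l) (hL : 0 < P.Ld ρ) (hR : 0 < P.Rd ρ 0) (hε : 0 < ε)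
    (he : 0 < e) (heε : e ≤ ε / 4) (hεR : ε ≤ 8 * P.Ld ρ * P.Rd ρ 0 ^ 2)
    {l : EuclideanSpace ℝ (Fin p)} {u : EuclideanSpace ℝ (Fin n)} (hl : l ∈ P.Kd)
    (hopt : P.Fstar - ε ≤ P.dual ρ l) (hu : P.InnerSol ρ e l u)
    (hB : √(2 * P.Ld ρ) * (√ε + √e) ≤ B)
    (hlB : ‖l‖ * (√(2 * P.Ld ρ) * (√ε + √e)) ≤ 4 * P.Rd ρ 0 * B) :
    Metric.infDist (P.con u) P.K ≤ B ∧ |P.F u - P.Fstar| ≤ 4 * P.Rd ρ 0 * B + e := by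
  have hU : P.U.Nonempty := hfeas.mono fun _ h => h.1
  have hdual := P.isStrongDual hρ hL hU
  obtain ⟨ls, hls, hlsopt, hlsR⟩ := P.exists_norm_eq_Rd hρ hfeas hmult
  set L := P.Ld ρ
  set R := P.Rd ρ 0
  have ha : 0 < √ε := by positivity
  have hb : 0 < √e := by positivity
  have hsε : √ε ^ 2 = ε := Real.sq_sqrt hε.le
  have hse : √e ^ 2 = e := Real.sq_sqrt he.le
  have hgrad := hu.inexactGrad hρ.nonneg
  rw [← hse] at hgrad
  have hle : ∀ l' ∈ P.Kd, P.dual ρ l' ≤ P.dual ρ l + √ε ^ 2 := fun l' hl' => by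
    rw [hsε]
    linarith [P.dual_le_Fstar hρ hfeas hl']
  obtain ⟨w, hrw, hdist, hwK⟩ := P.exists_feasible_direction hρ u l
  have hw := hdual.norm_le_of_nearly_optimal hL ha hb hgrad hrw
    fun c hc => hle _ (hwK l hl c hc)
  have hcompl := hdual.neg_inner_le_of_nearly_optimal hL ha hb (hsε.le.trans hεR) hR hgrad
    fun c hc hc1 => hle _ (by
      have := P.Kd_convex hl P.zero_mem_Kd (sub_nonneg.2 hc1) hc (by ring)
      convert this using 1
      module)
  set D := Metric.infDist (P.con u) P.K
  have hD0 : 0 ≤ D := Metric.infDist_nonneg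
  have hDB : D ≤ B := (hdist.trans hw).trans hB
  refine ⟨hDB, abs_le.2 ⟨?_, ?_⟩⟩
  · have h1 := P.Fstar_sub_F_le hρ hls hlsopt hu.1
    rw [hlsR] at h1
    have h2 := sqrt_two_mul_le hL hR hεR
    have hba : √e ≤ √ε / 2 := by
      refine le_of_sq_le_sq ?_ (by positivity)
      rw [div_pow, hsε, hse]
      linarith
    have hD6 : D ≤ 6 * L * R := by
      have h3 : √(2 * L) * (√ε + √e) ≤ √(2 * L) * (√ε + √ε / 2) := by gcongr
      linarith [hdist.trans hw]
    -- the penalty term is absorbed by `D ≤ 6 * L * R` and `ρ ≤ 1 / L`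
    have h4 : ρ / 2 * D ^ 2 ≤ 3 * R * D := by
      calc ρ / 2 * D ^ 2 ≤ (1 / L) / 2 * D ^ 2 := by
            gcongr
            exact P.rho_le hρ hL
        _ = 1 / (2 * L) * D * D := by field_simp
        _ ≤ 1 / (2 * L) * (6 * L * R) * D := by gcongr
        _ = 3 * R * D := by field_simp; ring
    have h5 : R * D ≤ R * B := by gcongr
    change P.Fstar - P.F u ≤ R * D + ρ / 2 * D ^ 2 at h1
    linarith
  · have h1 : max (4 * R) ‖l‖ * (√(2 * L) * (√ε + √e)) ≤ 4 * R * B := by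
      rcases max_cases (4 * R) ‖l‖ with ⟨h, _⟩ | ⟨h, _⟩ <;> rw [h]
      · gcongr
      · exact hlB
    have h2 := P.lagr_eq ρ u l
    have h3 : 0 ≤ ρ / 2 * ‖P.resid ρ u l‖ ^ 2 :=
      mul_nonneg (div_nonneg hρ.nonneg zero_le_two) (sq_nonneg _)
    linarith [hu.2.2, P.dual_le_Fstar hρ hfeas hl]

end QP

/-! ### Rates of the two schemes -/

section Schemes

variable {n p : ℕ} {P : QP n p} {ρ e : ℝ} {m : Scheme}
  {lam mu : ℕ → EuclideanSpace ℝ (Fin p)} {u : ℕ → EuclideanSpace ℝ (Fin n)}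

theorem IsDFOM.lam_mem (h : IsDFOM P ρ m e 0 lam mu u) (k : ℕ) : lam k ∈ P.Kd := by
  cases k with
  | zero => rw [h.lam_zero]; exact P.zero_mem_Kd
  | succ k => rw [h.step (k + 1) (by omega)]; exact P.dualStep_mem _ _ _

theorem IsDFOM.step_le (h : IsDFOM P ρ m e 0 lam mu u) (hρ : P.Admissible ρ) (hL : 0 < P.Ld ρ)
    (hU : P.U.Nonempty) (k : ℕ) {w : EuclideanSpace ℝ (Fin p)} (hw : w ∈ P.Kd) :
    P.dual ρ w - P.Ld ρ * ‖w - mu (k + 1)‖ ^ 2 + P.Ld ρ * ‖lam (k + 1) - w‖ ^ 2 - 2 * e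
      ≤ P.dual ρ (lam (k + 1)) := by
  have hs := h.step (k + 1) (by omega)
  rw [hs]
  exact (P.isStrongDual hρ hL hU).step_le hL
    ((h.inner (k + 1) (by omega)).inexactGrad hρ.nonneg) (P.inner_dualStep_le _ _ _ hw)

theorem IsDFOM.mu_succ_gradient (h : IsDFOM P ρ Scheme.DGM e 0 lam mu u) (k : ℕ) :
    mu (k + 1) = lam k := by
  cases k with
  | zero => rw [zero_add, h.mu_one, h.lam_zero]
  | succ k => simp [h.extrapolate (k + 1) (by omega), beta, theta]

theorem IsDFOM.smul_mu_succ_fast (h : IsDFOM P ρ Scheme.DFGM e 0 lam mu u) (k : ℕ) :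
    fastTheta (k + 1) • mu (k + 1)
      = fastTheta (k + 1) • lam k + (fastTheta k - 1) • (lam k - lam (k - 1)) := by
  cases k with
  | zero => simp [h.mu_one, h.lam_zero]
  | succ k =>
    have hθ := one_le_fastTheta (k + 1)
    rw [h.extrapolate (k + 1) (by omega), smul_add, smul_smul, beta, theta, theta,
      mul_div_cancel₀ _ (by linarith)]

theorem avg_mem (h : IsDFOM P ρ m e 0 lam mu u) (k : ℕ) : avg lam k ∈ P.Kd := by
  have hk : (0 : ℝ) < k + 1 := by positivity
  rw [avg, Finset.smul_sum]
  exact P.Kd_convex.sum_mem (fun _ _ => by positivity) (by simp [hk.ne'])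
    fun j _ => h.lam_mem j

/-- The last dual iterate of the gradient method. -/
theorem gradient_last {ε : ℝ} (hρ : P.Admissible ρ) (hfeas : P.feasible.Nonempty)
    (hmult : ∃ l, P.IsLagrangeMultiplier l) (hL : 0 < P.Ld ρ) (hε : 0 < ε)
    (hεR : ε ≤ 8 * P.Ld ρ * P.Rd ρ 0 ^ 2)
    (hrun : IsDFOM P ρ Scheme.DGM (ε / 4) 0 lam mu u) {k : ℕ}
    (hk : k = ⌈8 * P.Ld ρ * P.Rd ρ 0 ^ 2 / ε⌉₊) {w : EuclideanSpace ℝ (Fin n)}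
    (hw : P.InnerSol ρ (ε / 4) (avg lam k) w) :
    P.Fstar - ε ≤ P.dual ρ (P.dualStep ρ w (avg lam k)) ∧
      ‖P.dualStep ρ w (avg lam k)‖ ≤ 4 * P.Rd ρ 0 := by
  have hU : P.U.Nonempty := hfeas.mono fun _ h => h.1
  have hdual := P.isStrongDual hρ hL hU
  obtain ⟨ls, hls, hlsopt, hlsR⟩ := P.exists_norm_eq_Rd hρ hfeas hmult
  have h0 := P.Fstar_sub_le_dual_zero hρ hL hfeas hls hlsopt
  have hR0 : 0 ≤ P.Rd ρ 0 := Metric.infDist_nonneg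
  have havg := avg_mem hrun k
  have hgrad := hw.inexactGrad hρ.nonneg
  have hself := hdual.sub_le_step hL hgrad (P.inner_dualStep_le _ _ _ havg)
  have hlast := hdual.step_le hL hgrad (P.inner_dualStep_le ρ w (avg lam k) hls)
  have hmem := P.dualStep_mem ρ w (avg lam k)
  set x := P.dualStep ρ w (avg lam k)
  set L := P.Ld ρ
  set R := P.Rd ρ 0
  have hstep : ∀ k, P.dual ρ ls - L * ‖ls - lam k‖ ^ 2 + L * ‖lam (k + 1) - ls‖ ^ 2
      - 2 * (ε / 4) ≤ P.dual ρ (lam (k + 1)) := fun k => by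
    have := hrun.step_le hρ hL hU k hls
    rwa [hrun.mu_succ_gradient] at this
  have hstart : ‖lam 0 - ls‖ = R := by rw [hrun.lam_zero, zero_sub, norm_neg, hlsR]
  have hmax : ∀ k, P.dual ρ (lam k) ≤ P.dual ρ ls := fun k =>
    hlsopt ▸ P.dual_le_Fstar hρ hfeas (hrun.lam_mem k)
  have hκ : 8 * L * R ^ 2 / ε ≤ k := hk ▸ Nat.le_ceil _
  have hκ1 : 1 ≤ 8 * L * R ^ 2 / ε := by rwa [le_div_iff₀ hε, one_mul]
  have hκ2 : (k : ℝ) < 8 * L * R ^ 2 / ε + 1 := hk ▸ Nat.ceil_lt_add_one (by linarith)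
  have hk8 : 8 * L * R ^ 2 ≤ k * ε := by rwa [div_le_iff₀ hε] at hκ
  have hk16 : k * ε ≤ 16 * L * R ^ 2 := by
    have h1 : (k : ℝ) ≤ 2 * (8 * L * R ^ 2 / ε) := by linarith
    calc k * ε ≤ 2 * (8 * L * R ^ 2 / ε) * ε := by gcongr
      _ = 16 * L * R ^ 2 := by field_simp; ring
  constructor
  · have h1 := gradient_avg hdual.concaveOn hL hstep
      (by rw [hrun.lam_zero, zero_sub, norm_neg, hlsopt]; exact h0) k
    rw [← avg, hstart, hlsopt] at h1
    have hk1 : (0 : ℝ) < k + 1 := by positivity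
    have h2 : ((k : ℝ) + 1) * (P.Fstar - 3 / 4 * ε) ≤ (k + 1) * P.dual ρ (avg lam k) := by
      linarith
    have h3 := le_of_mul_le_mul_left h2 hk1
    linarith
  · have h1 : ∀ k : ℕ, ‖lam k - ls‖ ^ 2 ≤ R ^ 2 + k * (2 * (ε / 4 / L)) := fun k => by
      have := gradient_dist_sq_le hL hstep hmax k
      rw [hstart] at this
      rwa [← mul_div_assoc 2]
    have h2 := norm_avg_sub_sq_le h1 k
    rw [← avg] at h2
    have h3 : L * ‖avg lam k - ls‖ ^ 2 ≤ 5 * L * R ^ 2 := by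
      calc L * ‖avg lam k - ls‖ ^ 2 ≤ L * (R ^ 2 + k * (ε / 4 / L)) := by gcongr
        _ = L * R ^ 2 + k * ε / 4 := by field_simp
        _ ≤ _ := by linarith
    have h4 : L * ‖x - ls‖ ^ 2 ≤ L * (3 * R) ^ 2 := by
      rw [norm_sub_rev ls, hlsopt] at hlast
      linarith [P.dual_le_Fstar hρ hfeas hmem]
    have h5 : ‖x - ls‖ ≤ 3 * R :=
      le_of_sq_le_sq (le_of_mul_le_mul_left h4 hL) (by positivity)
    have h6 := norm_add_le (x - ls) ls
    rw [sub_add_cancel, hlsR] at h6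
    linarith

/-- The last dual iterate of the fast gradient method, with `ε = 8 L R² / κ²` and
`e = 2 L R² / κ³`. -/
theorem fast_last {ε κ : ℝ} (hρ : P.Admissible ρ) (hfeas : P.feasible.Nonempty)
    (hmult : ∃ l, P.IsLagrangeMultiplier l) (hL : 0 < P.Ld ρ) (hR : 0 < P.Rd ρ 0)
    (hκ : 1 ≤ κ) (hεκ : ε * κ ^ 2 = 8 * P.Ld ρ * P.Rd ρ 0 ^ 2)
    (heκ : e * κ ^ 3 = 2 * P.Ld ρ * P.Rd ρ 0 ^ 2)
    (hrun : IsDFOM P ρ Scheme.DFGM e 0 lam mu u) {k : ℕ} (hk : k = ⌈κ⌉₊) :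
    P.Fstar - ε ≤ P.dual ρ (lam k) ∧
      (‖lam k‖ ≤ 4 * P.Rd ρ 0 ∨ (κ ≤ 1.3 ∧ ‖lam k‖ ≤ 4.4 * P.Rd ρ 0)) := by
  have hU : P.U.Nonempty := hfeas.mono fun _ h => h.1
  have hdual := P.isStrongDual hρ hL hU
  obtain ⟨ls, hls, hlsopt, hlsR⟩ := P.exists_norm_eq_Rd hρ hfeas hmult
  have hstart : ‖lam 0 - ls‖ = P.Rd ρ 0 := by rw [hrun.lam_zero, zero_sub, norm_neg, hlsR]
  have hpot := fast_potential hdual.concaveOn P.Kd_convex hls hrun.lam_mem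
    (fun k x hx => hrun.step_le hρ hL hU k hx) hrun.smul_mu_succ_fast
  simp only [hstart, hlsopt] at hpot
  constructor
  · have := fast_rate hL hR hκ hk hεκ heκ (hpot k)
    linarith
  · have hz : ∀ j, P.Ld ρ * ‖auxPoint lam j - ls‖ ^ 2
        ≤ P.Ld ρ * P.Rd ρ 0 ^ 2 + 2 * e * thetaSum j := fun j => by
      have h1 : 0 ≤ fastTheta j ^ 2 * (P.Fstar - P.dual ρ (lam j)) :=
        mul_nonneg (sq_nonneg _) (sub_nonneg.2 (P.dual_le_Fstar hρ hfeas (hrun.lam_mem j)))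
      linarith [hpot j]
    have h6 := norm_add_le (lam k - ls) ls
    rw [sub_add_cancel, hlsR] at h6
    rcases fast_dist hL hR hκ hk heκ hz with h | ⟨h1, h2⟩
    · exact Or.inl (by linarith)
    · exact Or.inr ⟨h1, by linarith⟩

end Schemes

/-- The inner accuracy and the iteration count of the fast method in terms of `κ`. -/
theorem fast_parameters {ε L R κ : ℝ} (hε : 0 < ε) (hL : 0 < L) (hR : 0 < R)
    (hκ : κ = √(8 * L * R ^ 2 / ε)) :
    ε * κ ^ 2 = 8 * L * R ^ 2 ∧ ε * √ε / (8 * R * √(2 * L)) * κ ^ 3 = 2 * L * R ^ 2 := by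
  have h1 : κ = 2 * √(2 * L) * R / √ε := by
    rw [hκ, Real.sqrt_div (by positivity)]
    congr 1
    rw [Real.sqrt_eq_iff_mul_self_eq (by positivity) (by positivity)]
    have := Real.mul_self_sqrt (by positivity : 0 ≤ 2 * L)
    linear_combination (-4 * R ^ 2) * this
  have h2 : √(2 * L) ^ 2 = 2 * L := Real.sq_sqrt (by positivity)
  have h3 : √ε ^ 2 = ε := Real.sq_sqrt hε.le
  have hs : 0 < √ε := by positivity
  have hs' : 0 < √(2 * L) := by positivity
  have e1 : ε * κ ^ 2 = 8 * L * R ^ 2 := by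
    rw [hκ, Real.sq_sqrt (by positivity)]
    field_simp
  refine ⟨e1, ?_⟩
  calc ε * √ε / (8 * R * √(2 * L)) * κ ^ 3
      = (ε * κ ^ 2) * (√ε * κ) / (8 * R * √(2 * L)) := by ring
    _ = (8 * L * R ^ 2) * (2 * √(2 * L) * R) / (8 * R * √(2 * L)) := by
      rw [e1, h1, mul_div_cancel₀ _ hs.ne']
    _ = 2 * L * R ^ 2 := by field_simp

end DuQuad

theorem mainTheorem2 {n p : ℕ} (P : DuQuad.QP n p) (ρ ε : ℝ) (m : DuQuad.Scheme)
    (hρ : P.Admissible ρ)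
    (hfeas : P.feasible.Nonempty)
    (hmult : ∃ l, P.IsLagrangeMultiplier l)
    (hε : 0 < ε)
    (hk : 1 ≤ DuQuad.kOutReal m ε (P.Ld ρ) (P.Rd ρ 0))
    (lam mu : ℕ → EuclideanSpace ℝ (Fin p)) (u : ℕ → EuclideanSpace ℝ (Fin n))
    (hrun : DuQuad.IsDFOM P ρ m (DuQuad.epsIn m ε (P.Ld ρ) (P.Rd ρ 0)) 0 lam mu u)
    (lLast : EuclideanSpace ℝ (Fin p))
    (hlLast : DuQuad.IsDualLast P ρ m (DuQuad.epsIn m ε (P.Ld ρ) (P.Rd ρ 0)) lam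
      (DuQuad.kOut m ε (P.Ld ρ) (P.Rd ρ 0)) lLast)
    (uLast : EuclideanSpace ℝ (Fin n))
    (huLast : P.InnerSol ρ (DuQuad.epsIn m ε (P.Ld ρ) (P.Rd ρ 0)) lLast uLast) :
    (Metric.infDist (P.con uLast) P.K ≤ DuQuad.feasBound ε (P.Ld ρ) (P.Rd ρ 0) ∧
      |P.F uLast - P.Fstar| ≤ 4 * P.Rd ρ 0 * DuQuad.feasBound ε (P.Ld ρ) (P.Rd ρ 0)
        + DuQuad.epsIn m ε (P.Ld ρ) (P.Rd ρ 0)) ∧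
    (Metric.infDist (P.con uLast) P.K ≤ 3 * √(P.Ld ρ) * √ε ∧
      |P.F uLast - P.Fstar| ≤ 11 * P.Rd ρ 0 * √(P.Ld ρ) * √ε) := by
  have hL0 := P.Ld_nonneg hρ
  have hR0 : 0 ≤ P.Rd ρ 0 := Metric.infDist_nonneg
  have hκ : 1 ≤ 8 * P.Ld ρ * P.Rd ρ 0 ^ 2 / ε := by
    cases m with
    | DGM => exact hk
    | DFGM => exact Real.one_le_sqrt.1 hk
  have hεR : ε ≤ 8 * P.Ld ρ * P.Rd ρ 0 ^ 2 := by rwa [le_div_iff₀ hε, one_mul] at hκ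
  -- in the degenerate cases `L_d = 0` or `R_d = 0` the number of iterations would be zero
  have hL : 0 < P.Ld ρ := hL0.lt_of_ne fun h => by rw [← h] at hεR; linarith
  have hR : 0 < P.Rd ρ 0 := hR0.lt_of_ne fun h => by
    rw [← h] at hεR
    linarith
  have hfast := DuQuad.fast_parameters hε hL hR rfl
  have hmain : (0 < DuQuad.epsIn m ε (P.Ld ρ) (P.Rd ρ 0) ∧
        DuQuad.epsIn m ε (P.Ld ρ) (P.Rd ρ 0) ≤ ε / 4) ∧
      (Metric.infDist (P.con uLast) P.K ≤ DuQuad.feasBound ε (P.Ld ρ) (P.Rd ρ 0) ∧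
      |P.F uLast - P.Fstar| ≤ 4 * P.Rd ρ 0 * DuQuad.feasBound ε (P.Ld ρ) (P.Rd ρ 0)
        + DuQuad.epsIn m ε (P.Ld ρ) (P.Rd ρ 0)) := by
    cases m with
    | DGM =>
      obtain ⟨w, hw, rfl⟩ := hlLast
      obtain ⟨hopt, hnorm⟩ :=
        DuQuad.gradient_last hρ hfeas hmult hL hε hεR hrun rfl hw
      have hB := DuQuad.gradient_le_feasBound (R := P.Rd ρ 0) hε hL
      have he : 0 < DuQuad.epsIn .DGM ε (P.Ld ρ) (P.Rd ρ 0) := by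
        rw [DuQuad.epsIn]; positivity
      refine ⟨⟨he, le_rfl⟩, P.primal_bounds hρ hfeas hmult hL hR hε he le_rfl hεR
        (P.dualStep_mem _ _ _) hopt huLast hB ?_⟩
      exact mul_le_mul hnorm hB (by positivity) (by positivity)
    | DFGM =>
      have hl : lLast = lam _ := hlLast
      subst hl
      have hB := DuQuad.fast_error_le hε hL hR
      simp only [DuQuad.kOutReal, DuQuad.epsIn, DuQuad.kOut] at *
      set κ := √(8 * P.Ld ρ * P.Rd ρ 0 ^ 2 / ε) with hκdef
      set e := ε * √ε / (8 * P.Rd ρ 0 * √(2 * P.Ld ρ)) with hedef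
      have he : 0 < e := by positivity
      have heκ : 4 * κ * e = ε := by
        have h1 : 4 * κ * e * κ ^ 2 = ε * κ ^ 2 := by
          linear_combination 4 * hfast.2 - hfast.1
        exact mul_right_cancel₀ (by positivity) h1
      have heε : e ≤ ε / 4 := by nlinarith
      obtain ⟨hopt, hnorm⟩ :=
        DuQuad.fast_last hρ hfeas hmult hL hR hk hfast.1 hfast.2 hrun rfl
      have ha : 0 < √(2 * P.Ld ρ) * √ε := by positivity
      have hb : 0 < √(2 * P.Ld ρ) * √e := by positivity
      have hB' : √(2 * P.Ld ρ) * (√ε + √e) ≤ DuQuad.feasBound ε (P.Ld ρ) (P.Rd ρ 0) := by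
        linarith
      refine ⟨⟨he, heε⟩, P.primal_bounds hρ hfeas hmult hL hR hε he heε hεR
        (hrun.lam_mem _) hopt huLast hB' ?_⟩
      rcases hnorm with h | ⟨h1, h2⟩
      · exact mul_le_mul h hB' (by positivity) (by positivity)
      · -- here the inner error is a fixed fraction of `ε`, so that the margin in the
        -- feasibility bound compensates for the larger multiplier
        have hab : √ε ≤ 2.7 * √e := by
          refine le_of_sq_le_sq ?_ (by positivity)
          rw [mul_pow, Real.sq_sqrt hε.le, Real.sq_sqrt he.le]
          nlinarith
        have hab' := mul_le_mul_of_nonneg_left hab (Real.sqrt_nonneg (2 * P.Ld ρ))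
        have h3 : 4.4 * (√(2 * P.Ld ρ) * (√ε + √e))
            ≤ 4 * DuQuad.feasBound ε (P.Ld ρ) (P.Rd ρ 0) := by
          linarith
        calc _ ≤ 4.4 * P.Rd ρ 0 * (√(2 * P.Ld ρ) * (√ε + √e)) := by gcongr
          _ = P.Rd ρ 0 * (4.4 * (√(2 * P.Ld ρ) * (√ε + √e))) := by ring
          _ ≤ P.Rd ρ 0 * (4 * DuQuad.feasBound ε (P.Ld ρ) (P.Rd ρ 0)) := by gcongr
          _ = _ := by ring
  obtain ⟨⟨he, heε⟩, hfeasB, hobjB⟩ := hmain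
  have hB := DuQuad.feasBound_le hε hL hR hεR
  have hp : 0 < √(P.Ld ρ) * √ε := by positivity
  refine ⟨⟨hfeasB, hobjB⟩, by linarith, hobjB.trans ?_⟩
  have h1 : 4 * P.Rd ρ 0 * DuQuad.feasBound ε (P.Ld ρ) (P.Rd ρ 0)
      ≤ 4 * P.Rd ρ 0 * (2.4 * (√(P.Ld ρ) * √ε)) := by gcongr
  have h2 : ε ≤ 4 * (P.Rd ρ 0 * (√(P.Ld ρ) * √ε)) := by
    have h3 : √ε ≤ 4 * (P.Rd ρ 0 * √(P.Ld ρ)) := by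
      refine Real.sqrt_le_iff.2 ⟨by positivity, ?_⟩
      rw [mul_pow, mul_pow, Real.sq_sqrt hL.le]
      nlinarith [mul_pos hL (pow_pos hR 2)]
    calc ε = √ε * √ε := (Real.mul_self_sqrt hε.le).symm
      _ ≤ 4 * (P.Rd ρ 0 * √(P.Ld ρ)) * √ε := by gcongr
      _ = _ := by ring
  linarith
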